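/- Let $(\Omega,\mathcal F,\mathbb P)$ be a complete probability space, $\sigma:\Omega\to\Omega$ an ergodic measure-preserving automorphism, $R>0$, and $c:\Omega\to\mathbb D(0,R)=\{z\in\mathbb C:|z|<R\}$ measurable (a bounded random system of quadratic maps). Put $f_\omega(z)=z^2+c(\omega)$ and $f^n_\omega=f_{\sigma^{n-1}\omega}\circ\dots\circ f_{\omega}$. Let $\mathcal A_\omega=\{z\in\mathbb C: f^n_\omega(z)\to\infty\}$, and let $J_\omega$ be the Julia set, i.e. the set of $z\in\mathbb C$ such that $(f^n_\omega)_{n\ge 0}$ is not a normal family (as maps to the Riemann sphere) on any open set containing $z$. Let $g_\omega(z)=\lim_{n\to\infty}2^{-n}\ln|f^n_\omega(z)|$ for $z\in\mathcal A_\omega$ and $g_\omega=0$ on $\mathbb C\setminus\mathcal A_\omega$, and let $\mu_\omega=\frac1{2\pi}\Delta g_\omega$ in the sense of distributions. Let $\mu$ be the measure on $\Omega\times\mathbb C$ given by $\mu(A)=\int_\Omega\mu_\omega(\{z:(\omega,z)\in A\})\,d\mathbb P(\omega)$. Define $$\chi_\omega=\int_{J_\omega}\ln|f_\omega'|\,d\mu_\omega,\qquad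 \chi=\int_\Omega\chi_\omega\,d\mathbb P(\omega),\qquad \mathbf g(0)=\int_\Omega g_\omega(0)\,d\mathbb P(\omega).$$ Then all these objects are well defined. For every $\omega\in\Omega$: the limit defining $g_\omega$ exists on $\mathcal A_\omega$; the distribution $\frac1{2\pi}\Delta g_\omega$ is a Borel probability measure $\mu_\omega$, with $\mu_\omega(\mathbb C\setminus J_\omega)=0$ and $\mu_\omega(\{0\})=0$; the function $\ln|f'_\omega|$ is $\mu_\omega$-integrable on $J_\omega$; and $$\chi_\omega=\int_{J_\omega}\ln|2z|\,d\mu_\omega(z)=\ln 2+g_\omega(0).$$ Moreover $\omega\mapsto\mu_\omega(B)$ is measurable for every Borel set $B\subset\mathbb C$, the functions $\omega\mapsto g_\omega(0)$ and $\omega\mapsto\chi_\omega$ are $\mathbb P$-integrable, $(\omega,z)\mapsto\ln|f'_\omega(z)|$ is $\mu$-integrable, and $$\chi=\int_{\Omega\times\mathbb C}\ln|f_\omega'(z)|\,d\mu(\omega,z)=\ln 2+\mathbf g(0).$$ -/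

import Mathlib

open Real Set Filter Topology MeasureTheory

/-- A bounded random system of quadratic maps over a probability space `(Ω, P)`: an ergodic
measure-preserving automorphism `σ` of the space, a constant `R > 0`, and a measurable
parameter map `c` with values in the open disc `𝔻(0, R)`. -/
structure BoundedRandomQuadraticSystem {Ω : Type*} [MeasurableSpace Ω] (P : Measure Ω) where
  /-- The driving automorphism. -/
  σ : Ω ≃ᵐ Ω
  ergodic : Ergodic σ P
  /-- The bound for the parameters. -/
  R : ℝ
  R_pos : 0 < R
  /-- The random parameter. -/
  c : Ω → ℂ
  measurable_c : Measurable c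
  c_mem : ∀ ω, c ω ∈ Metric.ball (0 : ℂ) R

/-- `IsNormalizedLaplacian u μ` says that `μ = (1 / 2π) Δu` in the sense of distributions on the
plane: `μ` is a locally finite Borel measure and `∫ φ dμ = (1 / 2π) ∫ u Δφ` for every real-valued
smooth compactly supported `φ`. -/
structure IsNormalizedLaplacian (u : ℂ → ℝ) (μ : Measure ℂ) : Prop where
  locallyFinite : IsLocallyFiniteMeasure μ
  integral_eq : ∀ φ : ℂ → ℝ, ContDiff ℝ (⊤ : ℕ∞) φ → HasCompactSupport φ →
    ∫ z, φ z ∂μ = (2 * π)⁻¹ * ∫ z, u z * Laplacian.laplacian φ z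

open Classical in
/-- The measure `(1 / 2π) Δu`. There is at most one, because smooth compactly supported functions
determine a locally finite Borel measure on the plane; the value is `0` if there is none. -/
noncomputable def normalizedLaplacian (u : ℂ → ℝ) : Measure ℂ :=
  if h : ∃ μ, IsNormalizedLaplacian u μ then h.choose else 0

/-- A sequence `F` of continuous functions on the plane is normal on `U`: every sequence
of its members has a subsequence converging locally uniformly on `U`, as maps to the Riemann
sphere `OnePoint ℂ` (the constant limit `∞` being allowed). Locally uniform convergence is
convergence in the compact-open topology of `C(U, OnePoint ℂ)`. -/
def IsNormalFamilyOn (F : ℕ → C(ℂ, ℂ)) (U : Set ℂ) : Prop :=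
  ∀ n : ℕ → ℕ, ∃ k : ℕ → ℕ, StrictMono k ∧ ∃ h : C(U, OnePoint ℂ),
    Tendsto (fun j => ((⟨OnePoint.some, OnePoint.continuous_coe⟩ : C(ℂ, OnePoint ℂ)).comp
      ((F (n (k j))).restrict U) : C(U, OnePoint ℂ))) atTop (𝓝 h)

namespace BoundedRandomQuadraticSystem

variable {Ω : Type*} [MeasurableSpace Ω] {P : Measure Ω} (S : BoundedRandomQuadraticSystem P)

/-- The fiber map `f_ω(z) = z² + c(ω)`. -/
def fiberMap (ω : Ω) (z : ℂ) : ℂ := z ^ 2 + S.c ω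

/-- The random iterate `f^n_ω = f_{σ^{n-1} ω} ∘ ⋯ ∘ f_{σ ω} ∘ f_ω`. -/
def iter (ω : Ω) : ℕ → ℂ → ℂ
  | 0, z => z
  | n + 1, z => S.fiberMap (S.σ^[n] ω) (iter ω n z)

theorem continuous_iter (ω : Ω) (n : ℕ) : Continuous (S.iter ω n) := by
  induction n with
  | zero => exact continuous_id
  | succ n ih => exact (ih.pow 2).add continuous_const

/-- The basin of infinity `𝒜_ω`. -/
def basin (ω : Ω) : Set ℂ := {z | Tendsto (fun n => S.iter ω n z) atTop (Bornology.cobounded ℂ)}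

/-- The Julia set `J_ω`: the points without an open neighbourhood on which the iterates
form a normal family. -/
def julia (ω : Ω) : Set ℂ :=
  {z | ∀ U : Set ℂ, IsOpen U → z ∈ U →
    ¬ IsNormalFamilyOn (fun n => ⟨S.iter ω n, S.continuous_iter ω n⟩) U}

open Classical in
/-- The Green function `g_ω(z) = lim 2^{-n} ln |f^n_ω(z)|` of the basin of infinity,
extended by `0` to the complement of the basin. -/
noncomputable def green (ω : Ω) (z : ℂ) : ℝ :=
  if z ∈ S.basin ω then limUnder atTop (fun n : ℕ => Real.log ‖S.iter ω n z‖ / 2 ^ n) else 0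

/-- The equilibrium (harmonic) measure `μ_ω = (1 / 2π) Δ g_ω`. -/
noncomputable def equilibriumMeasure (ω : Ω) : Measure ℂ := normalizedLaplacian (S.green ω)

/-- The global measure on `Ω × ℂ` with marginal `P` on `Ω` and fiber measures `μ_ω`:
`μ(A) = ∫ μ_ω {z | (ω, z) ∈ A} dP(ω)`. -/
noncomputable def globalMeasure : Measure (Ω × ℂ) :=
  P.bind fun ω => (S.equilibriumMeasure ω).map (Prod.mk ω)

/-- The global Green function `𝐠(z) = ∫ g_ω(z) dP(ω)`. -/
noncomputable def globalGreen (z : ℂ) : ℝ := ∫ ω, S.green ω z ∂P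

/-- The fiberwise Lyapunov exponent `χ_ω = ∫_{J_ω} ln |f_ω'| dμ_ω`. -/
noncomputable def fiberLyapunov (ω : Ω) : ℝ :=
  ∫ z in S.julia ω, Real.log ‖deriv (S.fiberMap ω) z‖ ∂(S.equilibriumMeasure ω)

/-- The global Lyapunov exponent `χ = ∫ χ_ω dP(ω)`. -/
noncomputable def globalLyapunov : ℝ := ∫ ω, S.fiberLyapunov ω ∂P

end BoundedRandomQuadraticSystem

/-! The formula is a Jensen-type identity. Since `log ‖2 * z‖ = log 2 + log ‖0 - z‖`, it amounts to
saying that `g_ω` is the logarithmic potential of `μ_ω`, evaluated at the critical point `0`. The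
weight of the proof is this potential representation, together with the absence of atoms.

The measure is built by pull-back. Arc length on the unit circle has potential `log⁺ ‖z‖`, and the
factorization of `z ^ 2 + c - w` turns a potential `u` into `u (z ^ 2 + c) / 2`
(`HasLogPotential.quadPullback`). After `n` pull-backs the potential is `log⁺ ‖f^n z‖ / 2 ^ n`,
which converges uniformly to the Green function. The measures live on a fixed disc, so they have a
weak limit point. Jensen's formula expresses circle averages of a potential through a continuous
truncated kernel, and in this form the representation survives the limit
(`HasLogPotential.of_tendsto`). Smoothing the kernel shows that the limit measure is the
distributional Laplacian of its potential, and uniqueness identifies it with `μ_ω`.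

Near a point of normality either infinitely many iterates are bounded, so `g_ω = 0` and its
Laplacian vanishes there, or some iterate is beyond the escape radius, and the pulled-back circles
eventually miss the neighbourhood. Measurability in `ω` comes from testing against smooth functions,
and integrability over `Ω` from bounds depending only on `R`. -/

/-! ### Green's identity on the plane -/

theorem laplacian_eq_fderiv_fderiv {f : ℂ → ℝ} (hf : ContDiff ℝ 2 f) (x : ℂ) :
    Laplacian.laplacian f x = fderiv ℝ (fun y => fderiv ℝ f y 1) x 1 +
      fderiv ℝ (fun y => fderiv ℝ f y Complex.I) x Complex.I := by
  have hd : DifferentiableAt ℝ (fderiv ℝ f) x :=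
    ((hf.fderiv_right (m := 1) (by norm_num)).differentiable (by norm_num)).differentiableAt
  rw [InnerProductSpace.laplacian_eq_iteratedFDeriv_complexPlane]
  simp only [iteratedFDeriv_two_apply, Matrix.cons_val_zero, Matrix.cons_val_one]
  rw [fderiv_clm_apply hd (by fun_prop), fderiv_clm_apply hd (by fun_prop)]
  simp

theorem integral_mul_fderiv_fderiv {f φ : ℂ → ℝ} (hf : ContDiff ℝ 2 f) (hφ : ContDiff ℝ 2 φ)
    (hc : HasCompactSupport φ) (v : ℂ) :
    ∫ x, f x * fderiv ℝ (fun y => fderiv ℝ φ y v) x v =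
      ∫ x, fderiv ℝ (fun y => fderiv ℝ f y v) x v * φ x := by
  have hf1 : ContDiff ℝ 1 (fun y => fderiv ℝ f y v) :=
    (hf.fderiv_right (m := 1) (by norm_num)).clm_apply contDiff_const
  have hφ1 : ContDiff ℝ 1 (fun y => fderiv ℝ φ y v) :=
    (hφ.fderiv_right (m := 1) (by norm_num)).clm_apply contDiff_const
  have hf2 : Continuous fun x => fderiv ℝ (fun y => fderiv ℝ f y v) x v :=
    (hf1.continuous_fderiv (by norm_num)).clm_apply continuous_const
  have hφ2 : Continuous fun x => fderiv ℝ (fun y => fderiv ℝ φ y v) x v :=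
    (hφ1.continuous_fderiv (by norm_num)).clm_apply continuous_const
  have hc1 : HasCompactSupport fun y => fderiv ℝ φ y v := hc.fderiv_apply ℝ v
  have hc2 : HasCompactSupport fun x => fderiv ℝ (fun y => fderiv ℝ φ y v) x v :=
    hc1.fderiv_apply ℝ v
  have key : ∀ {a b : ℂ → ℝ}, Continuous a → Continuous b → HasCompactSupport b →
      Integrable fun x => a x * b x := fun ha hb hcb =>
    (ha.mul hb).integrable_of_hasCompactSupport hcb.mul_left
  have df : Differentiable ℝ f := hf.differentiable (by norm_num)
  have dφ : Differentiable ℝ φ := hφ.differentiable (by norm_num)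
  have df1 := hf1.differentiable (by norm_num)
  have dφ1 := hφ1.differentiable (by norm_num)
  rw [integral_mul_fderiv_eq_neg_fderiv_mul_of_integrable
      (key hf1.continuous hφ1.continuous hc1) (key hf.continuous hφ2 hc2)
      (key hf.continuous hφ1.continuous hc1) (fun x _ => df x) (fun x _ => dφ1 x),
    integral_mul_fderiv_eq_neg_fderiv_mul_of_integrable
      (key hf2 hφ.continuous hc) (key hf1.continuous hφ1.continuous hc1)
      (key hf1.continuous hφ.continuous hc) (fun x _ => df1 x) (fun x _ => dφ x), neg_neg]

theorem continuous_laplacian {φ : ℂ → ℝ} (hφ : ContDiff ℝ 2 φ) :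
    Continuous (Laplacian.laplacian φ) := by
  have h1 : ∀ v : ℂ, ContDiff ℝ 1 (fun y => fderiv ℝ φ y v) := fun v =>
    (hφ.fderiv_right (m := 1) (by norm_num)).clm_apply contDiff_const
  have h2 : ∀ v : ℂ, Continuous fun x => fderiv ℝ (fun y => fderiv ℝ φ y v) x v := fun v =>
    ((h1 v).continuous_fderiv (by norm_num)).clm_apply continuous_const
  exact ((h2 1).add (h2 Complex.I)).congr fun x => (laplacian_eq_fderiv_fderiv hφ x).symm

theorem hasCompactSupport_laplacian {φ : ℂ → ℝ} (hφ : ContDiff ℝ 2 φ)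
    (hc : HasCompactSupport φ) : HasCompactSupport (Laplacian.laplacian φ) := by
  have h2 : ∀ v : ℂ, HasCompactSupport fun x => fderiv ℝ (fun y => fderiv ℝ φ y v) x v :=
    fun v => (hc.fderiv_apply ℝ v).fderiv_apply ℝ v
  have := (h2 1).add (h2 Complex.I)
  rwa [show Laplacian.laplacian φ = _ from funext fun x => laplacian_eq_fderiv_fderiv hφ x]

theorem integral_mul_laplacian {f φ : ℂ → ℝ} (hf : ContDiff ℝ 2 f) (hφ : ContDiff ℝ 2 φ)
    (hc : HasCompactSupport φ) :
    ∫ x, f x * Laplacian.laplacian φ x = ∫ x, Laplacian.laplacian f x * φ x := by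
  have h1 : ∀ {φ : ℂ → ℝ} (v : ℂ), ContDiff ℝ 2 φ →
      Continuous fun x => fderiv ℝ (fun y => fderiv ℝ φ y v) x v := fun v hφ =>
    (((hφ.fderiv_right (m := 1) (by norm_num)).clm_apply contDiff_const).continuous_fderiv
      (by norm_num)).clm_apply continuous_const
  have h2 : ∀ v : ℂ, HasCompactSupport fun x => fderiv ℝ (fun y => fderiv ℝ φ y v) x v :=
    fun v => (hc.fderiv_apply ℝ v).fderiv_apply ℝ v
  simp_rw [laplacian_eq_fderiv_fderiv hf, laplacian_eq_fderiv_fderiv hφ, mul_add, add_mul]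
  have key : ∀ {a b : ℂ → ℝ}, Continuous a → Continuous b → HasCompactSupport b →
      Integrable fun x => a x * b x := fun ha hb hcb =>
    (ha.mul hb).integrable_of_hasCompactSupport hcb.mul_left
  rw [integral_add (key hf.continuous (h1 1 hφ) (h2 1))
      (key hf.continuous (h1 _ hφ) (h2 Complex.I)),
    integral_add (key (h1 1 hf) hφ.continuous hc) (key (h1 _ hf) hφ.continuous hc),
    integral_mul_fderiv_fderiv hf hφ hc, integral_mul_fderiv_fderiv hf hφ hc]

/-! ### The regularized logarithmic kernel -/

/-- A smooth regularization of the logarithmic kernel `log ‖w‖`. -/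
noncomputable def smoothLog (ε : ℝ) (w : ℂ) : ℝ := Real.log (‖w‖ ^ 2 + ε ^ 2) / 2

theorem contDiff_smoothLog {ε : ℝ} (hε : 0 < ε) (ζ : ℂ) :
    ContDiff ℝ 2 fun z => smoothLog ε (z - ζ) := by
  unfold smoothLog
  refine ContDiff.div_const (ContDiff.log ?_ fun x => by positivity) _
  exact ((contDiff_id.sub contDiff_const).norm_sq ℝ).add contDiff_const

/-- The two second derivatives add up to `2 / q - 2 * ‖z - ζ‖ ^ 2 / q ^ 2` with `q = ‖z - ζ‖ ^ 2 + ε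
^ 2`. The result is `2π` times an approximate identity of width `ε`. -/
theorem laplacian_smoothLog {ε : ℝ} (hε : 0 < ε) (ζ z : ℂ) :
    Laplacian.laplacian (fun z => smoothLog ε (z - ζ)) z =
      2 * ε ^ 2 / (‖z - ζ‖ ^ 2 + ε ^ 2) ^ 2 := by
  have hN : ∀ x : ℂ, HasFDerivAt (fun z => ‖z - ζ‖ ^ 2 + ε ^ 2)
      (2 • innerSL ℝ (x - ζ)) x := fun x => by
    have := ((hasFDerivAt_id x).sub_const ζ).norm_sq.add_const (ε ^ 2)
    simpa using this
  have hpos : ∀ x : ℂ, 0 < ‖x - ζ‖ ^ 2 + ε ^ 2 := fun x => by positivity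
  have h1 : ∀ v x : ℂ, fderiv ℝ (fun z => smoothLog ε (z - ζ)) x v =
      inner ℝ (x - ζ) v / (‖x - ζ‖ ^ 2 + ε ^ 2) := fun v x => by
    have := ((hN x).log (hpos x).ne').mul_const (1 / 2 : ℝ)
    have h2 : HasFDerivAt (fun z => smoothLog ε (z - ζ)) _ x :=
      this.congr_of_eventuallyEq (Eventually.of_forall fun y => by simp [smoothLog]; ring)
    rw [h2.fderiv]
    have := (hpos x).ne'
    simp only [smul_apply, innerSL_apply_apply, smul_eq_mul, nsmul_eq_mul]
    field_simp
    norm_num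
  have h2 : ∀ v x : ℂ, fderiv ℝ (fun y => fderiv ℝ (fun z => smoothLog ε (z - ζ)) y v) x v =
      ‖v‖ ^ 2 / (‖x - ζ‖ ^ 2 + ε ^ 2) -
        2 * (inner ℝ (x - ζ) v) ^ 2 / (‖x - ζ‖ ^ 2 + ε ^ 2) ^ 2 := fun v x => by
    simp_rw [h1]
    have hi : HasFDerivAt (fun y : ℂ => (inner ℝ (y - ζ) v : ℝ)) (innerSL ℝ v) x := by
      have := (innerSL ℝ v).hasFDerivAt.comp x ((hasFDerivAt_id x).sub_const ζ)
      simpa [Function.comp_def, real_inner_comm] using this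
    have hq := hi.mul ((hasDerivAt_inv (hpos x).ne').comp_hasFDerivAt x (hN x))
    have hq' : HasFDerivAt (fun y : ℂ => (inner ℝ (y - ζ) v : ℝ) / (‖y - ζ‖ ^ 2 + ε ^ 2)) _ x := hq
    rw [hq'.fderiv]
    have := (hpos x).ne'
    simp only [smul_apply, innerSL_apply_apply, smul_eq_mul, nsmul_eq_mul,
      add_apply, Function.comp_apply, real_inner_self_eq_norm_sq]
    field_simp
    ring
  rw [laplacian_eq_fderiv_fderiv (contDiff_smoothLog hε ζ), h2, h2]
  have h3 : ‖z - ζ‖ ^ 2 = (inner ℝ (z - ζ) 1) ^ 2 + (inner ℝ (z - ζ) Complex.I) ^ 2 := by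
    simp [Complex.inner, Complex.sq_norm, Complex.normSq_apply]; ring
  have := (hpos z).ne'
  rw [norm_one, Complex.norm_I]
  field_simp
  rw [h3]; ring

theorem integral_cauchyKernel : ∫ w : ℂ, 2 / (‖w‖ ^ 2 + 1) ^ 2 = 2 * π := by
  rw [integral_fun_norm_addHaar volume (fun y : ℝ => 2 / (y ^ 2 + 1) ^ 2)]
  have hd : ∀ x ∈ Ioi (0 : ℝ), HasDerivAt (fun y : ℝ => -(y ^ 2 + 1)⁻¹)
      (x * (2 / (x ^ 2 + 1) ^ 2)) x := fun x _ => by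
    have := (((hasDerivAt_pow 2 x).add_const 1).inv (by positivity : x ^ 2 + 1 ≠ 0)).neg
    refine HasDerivAt.congr_deriv this ?_
    norm_num; ring
  have hcw : ContinuousWithinAt (fun y : ℝ => -(y ^ 2 + 1)⁻¹) (Ici 0) 0 := by
    refine Continuous.continuousWithinAt ?_
    exact (((continuous_pow 2).add continuous_const).inv₀ fun x =>
      (by positivity : (x : ℝ) ^ 2 + 1 ≠ 0)).neg
  have ht : Tendsto (fun y : ℝ => -(y ^ 2 + 1)⁻¹) atTop (𝓝 0) := by
    rw [← neg_zero]
    exact (tendsto_inv_atTop_zero.comp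
      (tendsto_atTop_add_const_right _ 1 (tendsto_pow_atTop two_ne_zero))).neg
  have := integral_Ioi_of_hasDerivAt_of_tendsto hcw hd
    (integrableOn_Ioi_deriv_of_nonneg hcw hd (fun x hx => by
      have : (0:ℝ) < x := hx
      positivity) ht) ht
  simp only [Complex.finrank_real_complex, Nat.add_one_sub_one, pow_one, smul_eq_mul, this]
  simp [Measure.real, Complex.volume_ball]

/-- A non-integrable function has Bochner integral `0` by convention, so the nonzero value already
computed forces integrability. -/
theorem integrable_cauchyKernel : Integrable fun w : ℂ => 2 / (‖w‖ ^ 2 + 1) ^ 2 := by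
  by_contra h
  have := integral_undef h
  rw [integral_cauchyKernel] at this
  exact absurd this (by positivity)

/-- Green's identity against the regularized kernel, in rescaled form. -/
theorem integral_smoothLog_mul_laplacian {ε : ℝ} (hε : 0 < ε) (ζ : ℂ) {φ : ℂ → ℝ}
    (hφ : ContDiff ℝ 2 φ) (hc : HasCompactSupport φ) :
    ∫ z, smoothLog ε (z - ζ) * Laplacian.laplacian φ z =
      ∫ w : ℂ, 2 / (‖w‖ ^ 2 + 1) ^ 2 * φ (ε • w + ζ) := by
  rw [integral_mul_laplacian (contDiff_smoothLog hε ζ) hφ hc]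
  simp_rw [laplacian_smoothLog hε]
  have h1 := integral_sub_right_eq_self
    (fun z : ℂ => 2 * ε ^ 2 / (‖z‖ ^ 2 + ε ^ 2) ^ 2 * φ (z + ζ)) ζ (μ := volume)
  have h2 := Measure.integral_comp_smul volume
    (fun z : ℂ => 2 * ε ^ 2 / (‖z‖ ^ 2 + ε ^ 2) ^ 2 * φ (z + ζ)) ε
  simp only [sub_add_cancel] at h1
  rw [h1]
  rw [Complex.finrank_real_complex, abs_of_pos (by positivity), smul_eq_mul] at h2
  have h3 : ∫ z : ℂ, 2 * ε ^ 2 / (‖z‖ ^ 2 + ε ^ 2) ^ 2 * φ (z + ζ) = ε ^ 2 *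
    ∫ z : ℂ, 2 * ε ^ 2 / (‖ε • z‖ ^ 2 + ε ^ 2) ^ 2 * φ (ε • z + ζ) := by
      rw [h2]; field_simp
  rw [h3, ← integral_const_mul]
  congr 1; ext w
  rw [norm_smul, Real.norm_of_nonneg hε.le]
  have : ‖w‖ ^ 2 + 1 ≠ 0 := by positivity
  rw [show (ε * ‖w‖) ^ 2 + ε ^ 2 = ε ^ 2 * (‖w‖ ^ 2 + 1) by ring]
  field_simp

/-- This bound and `log_le_smoothLog` are uniform in `ε ≤ 1` and serve dominated convergence as `ε →
0`; `log_radius_le_smoothLog` gives integrability at fixed `ε`. -/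
theorem smoothLog_le {ε : ℝ} (hε : 0 < ε) (h1 : ε ≤ 1) (w : ℂ) : smoothLog ε w ≤ ‖w‖ ^ 2 := by
  have h : 0 < ‖w‖ ^ 2 + ε ^ 2 := by positivity
  have := Real.log_le_sub_one_of_pos h
  unfold smoothLog
  nlinarith [sq_nonneg ‖w‖]

theorem log_le_smoothLog (ε : ℝ) {w : ℂ} (hw : w ≠ 0) : Real.log ‖w‖ ≤ smoothLog ε w := by
  have h : 0 < ‖w‖ := norm_pos_iff.2 hw
  have h2 : Real.log (‖w‖ ^ 2) ≤ Real.log (‖w‖ ^ 2 + ε ^ 2) :=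
    Real.log_le_log (by positivity) (by nlinarith [sq_nonneg ε])
  rw [Real.log_pow] at h2
  unfold smoothLog
  push_cast at h2
  linarith

theorem log_radius_le_smoothLog {ε : ℝ} (hε : 0 < ε) (w : ℂ) : Real.log ε ≤ smoothLog ε w := by
  have h2 : Real.log (ε ^ 2) ≤ Real.log (‖w‖ ^ 2 + ε ^ 2) :=
    Real.log_le_log (by positivity) (by nlinarith [sq_nonneg ‖w‖])
  rw [Real.log_pow] at h2
  unfold smoothLog
  push_cast at h2
  linarith

theorem continuous_smoothLog {ε : ℝ} (hε : 0 < ε) : Continuous (smoothLog ε) := by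
  unfold smoothLog
  refine Continuous.div_const (Continuous.log (by fun_prop) fun x => ?_) _
  positivity

/-! ### Logarithmic potentials and their Laplacians -/

/-- `u` is the logarithmic potential of `ν`, a compactly supported measure without atoms. -/
structure HasLogPotential (ν : Measure ℂ) (u : ℂ → ℝ) : Prop where
  exists_bound : ∃ B, ∀ᵐ ζ ∂ν, ‖ζ‖ ≤ B
  singleton : ∀ z, ν {z} = 0
  integrable : ∀ z, Integrable (fun ζ => Real.log ‖z - ζ‖) ν
  integral_eq : ∀ z, ∫ ζ, Real.log ‖z - ζ‖ ∂ν = u z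

namespace HasLogPotential

variable {ν : Measure ℂ} {u : ℂ → ℝ} {B : ℝ}

theorem ae_ne (h : HasLogPotential ν u) (z : ℂ) : ∀ᵐ ζ ∂ν, z - ζ ≠ 0 := by
  have : ∀ᵐ ζ ∂ν, ζ ∉ ({z} : Set ℂ) := measure_eq_zero_iff_ae_notMem.1 (h.singleton z)
  filter_upwards [this] with ζ hζ h0
  exact hζ (sub_eq_zero.1 h0).symm

theorem integrable_smoothLog [IsFiniteMeasure ν] (hB : ∀ᵐ ζ ∂ν, ‖ζ‖ ≤ B) {ε : ℝ}
    (hε : 0 < ε) (h1 : ε ≤ 1) (z : ℂ) : Integrable (fun ζ => smoothLog ε (z - ζ)) ν := by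
  refine Integrable.mono' (integrable_const (|Real.log ε| + (‖z‖ + B) ^ 2))
    ((continuous_smoothLog hε).comp (continuous_const.sub continuous_id)).aestronglyMeasurable ?_
  filter_upwards [hB] with ζ hζ
  have h2 : ‖z - ζ‖ ≤ ‖z‖ + B := (norm_sub_le _ _).trans (by gcongr)
  have h3 := smoothLog_le hε h1 (z - ζ)
  have h4 := log_radius_le_smoothLog hε (z - ζ)
  have h5 : ‖z - ζ‖ ^ 2 ≤ (‖z‖ + B) ^ 2 := by gcongr
  rw [Real.norm_eq_abs, abs_le]
  constructor
  · linarith [neg_abs_le (Real.log ε), sq_nonneg (‖z‖ + B)]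
  · linarith [abs_nonneg (Real.log ε)]

theorem integral_integral_smoothLog [IsProbabilityMeasure ν] (hB : ∀ᵐ ζ ∂ν, ‖ζ‖ ≤ B) {ε : ℝ}
    (hε : 0 < ε) (h1 : ε ≤ 1) {φ : ℂ → ℝ} (hφ : ContDiff ℝ 2 φ) (hc : HasCompactSupport φ) :
    ∫ z, (∫ ζ, smoothLog ε (z - ζ) ∂ν) * Laplacian.laplacian φ z =
      ∫ ζ, (∫ w : ℂ, 2 / (‖w‖ ^ 2 + 1) ^ 2 * φ (ε • w + ζ)) ∂ν := by
  simp_rw [← integral_smoothLog_mul_laplacian hε _ hφ hc, ← integral_mul_const]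
  refine integral_integral_swap ?_
  have hcont := continuous_laplacian hφ
  refine Integrable.mono' (g := fun p : ℂ × ℂ =>
    (|Real.log ε| + (‖p.1‖ + B) ^ 2) * |Laplacian.laplacian φ p.1|) ?_ ?_ ?_
  · refine Integrable.comp_fst (μ := volume) (ν := ν)
      (f := fun z : ℂ => (|Real.log ε| + (‖z‖ + B) ^ 2) * |Laplacian.laplacian φ z|) ?_
    refine Continuous.integrable_of_hasCompactSupport (by fun_prop) ?_
    exact (hasCompactSupport_laplacian hφ hc).abs.mul_left
  · refine Continuous.aestronglyMeasurable ?_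
    exact ((continuous_smoothLog hε).comp (continuous_fst.sub continuous_snd)).mul
      (hcont.comp continuous_fst)
  · filter_upwards [Measure.quasiMeasurePreserving_snd.ae hB] with p hζ
    have h2 : ‖p.1 - p.2‖ ≤ ‖p.1‖ + B := (norm_sub_le _ _).trans (by gcongr)
    have h3 := smoothLog_le hε h1 (p.1 - p.2)
    have h4 := log_radius_le_smoothLog hε (p.1 - p.2)
    have h5 : ‖p.1 - p.2‖ ^ 2 ≤ (‖p.1‖ + B) ^ 2 := by gcongr
    simp only [Function.uncurry, norm_mul, Real.norm_eq_abs]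
    refine mul_le_mul_of_nonneg_right (abs_le.2 ⟨?_, ?_⟩) (abs_nonneg _)
    · linarith [neg_abs_le (Real.log ε), sq_nonneg (‖p.1‖ + B)]
    · linarith [abs_nonneg (Real.log ε)]

/-- The kernel is integrable of mass `2π`, and `ε n • w + ζ → ζ` for each `w`; boundedness of `φ`
permits dominated convergence in both integrals. -/
theorem tendsto_integral_cauchyKernel [IsProbabilityMeasure ν] {φ : ℂ → ℝ} (hφ : Continuous φ)
    (hc : HasCompactSupport φ) {ε : ℕ → ℝ} (hε : Tendsto ε atTop (𝓝 0)) :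
    Tendsto (fun n => ∫ ζ, (∫ w : ℂ, 2 / (‖w‖ ^ 2 + 1) ^ 2 * φ (ε n • w + ζ)) ∂ν) atTop
      (𝓝 (2 * π * ∫ ζ, φ ζ ∂ν)) := by
  obtain ⟨M, hM⟩ := hφ.bounded_above_of_compact_support hc
  have hM' : ∀ (n : ℕ) (ζ w : ℂ), ‖2 / (‖w‖ ^ 2 + 1) ^ 2 * φ (ε n • w + ζ)‖ ≤
      2 / (‖w‖ ^ 2 + 1) ^ 2 * M := fun n ζ w => by
    rw [norm_mul, Real.norm_of_nonneg (by positivity : 0 ≤ 2 / (‖w‖ ^ 2 + 1) ^ 2)]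
    exact mul_le_mul_of_nonneg_left (hM _) (by positivity)
  have hint := integrable_cauchyKernel.mul_const M
  have hkc : Continuous fun w : ℂ => 2 / (‖w‖ ^ 2 + 1) ^ 2 :=
    continuous_const.div (by fun_prop) fun w => by positivity
  rw [← integral_const_mul]
  refine tendsto_integral_of_dominated_convergence (fun _ => ∫ w : ℂ, 2 / (‖w‖ ^ 2 + 1) ^ 2 * M)
    (fun n => ?_) (integrable_const _) (fun n => ?_) ?_
  · refine StronglyMeasurable.aestronglyMeasurable ?_
    refine StronglyMeasurable.integral_prod_right
      (f := fun (ζ w : ℂ) => 2 / (‖w‖ ^ 2 + 1) ^ 2 * φ (ε n • w + ζ)) ?_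
    refine Continuous.stronglyMeasurable ?_
    exact (hkc.comp continuous_snd).mul (hφ.comp (by fun_prop))
  · exact Eventually.of_forall fun ζ =>
      norm_integral_le_of_norm_le hint (Eventually.of_forall (hM' n ζ))
  · refine Eventually.of_forall fun ζ => ?_
    rw [← integral_cauchyKernel, ← integral_mul_const]
    refine tendsto_integral_of_dominated_convergence _ (fun n => ?_) hint
      (fun n => Eventually.of_forall (hM' n ζ)) (Eventually.of_forall fun w => ?_)
    · exact (hkc.mul (hφ.comp (by fun_prop))).aestronglyMeasurable
    · refine Tendsto.const_mul _ ((hφ.tendsto _).comp ?_)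
      simpa using (hε.smul_const w).add_const ζ

/-- A continuous logarithmic potential of a compactly supported probability measure has that
measure as its normalized Laplacian. -/
theorem isNormalizedLaplacian [IsProbabilityMeasure ν] (h : HasLogPotential ν u)
    (hu : Continuous u) : IsNormalizedLaplacian u ν := by
  obtain ⟨B, hB⟩ := h.exists_bound
  refine ⟨inferInstance, fun φ hφ hc => ?_⟩
  have hφ2 : ContDiff ℝ 2 φ := contDiff_infty.1 hφ 2
  set ε : ℕ → ℝ := fun n => 1 / ((n : ℝ) + 1) with hεdef
  have hε0 : Tendsto ε atTop (𝓝 0) := tendsto_one_div_add_atTop_nhds_zero_nat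
  have hε : ∀ n, 0 < ε n := fun n => by positivity
  have hε1 : ∀ n, ε n ≤ 1 := fun n => by
    rw [hεdef]; exact (div_le_one (by positivity)).2 (by linarith [n.cast_nonneg (α := ℝ)])
  have hup : ∀ n z, ∀ᵐ ζ ∂ν, smoothLog (ε n) (z - ζ) ≤ (‖z‖ + B) ^ 2 := fun n z => by
    filter_upwards [hB] with ζ hζ
    have h2 : ‖z - ζ‖ ≤ ‖z‖ + B := (norm_sub_le _ _).trans (by gcongr)
    exact (smoothLog_le (hε n) (hε1 n) _).trans (by gcongr)
  have hlow : ∀ n z, ∀ᵐ ζ ∂ν, Real.log ‖z - ζ‖ ≤ smoothLog (ε n) (z - ζ) := fun n z => by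
    filter_upwards [h.ae_ne z] with ζ hζ using log_le_smoothLog _ hζ
  have hlim : ∀ z, Tendsto (fun n => ∫ ζ, smoothLog (ε n) (z - ζ) ∂ν) atTop (𝓝 (u z)) := by
    intro z
    rw [← h.integral_eq z]
    refine tendsto_integral_of_dominated_convergence
      (fun ζ => |Real.log ‖z - ζ‖| + (‖z‖ + B) ^ 2) (fun n => ?_)
      ((h.integrable z).abs.add (integrable_const _)) (fun n => ?_) ?_
    · exact (integrable_smoothLog hB (hε n) (hε1 n) z).aestronglyMeasurable
    · filter_upwards [hup n z, hlow n z] with ζ h1 h2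
      rw [Real.norm_eq_abs, abs_le]
      constructor
      · linarith [neg_abs_le (Real.log ‖z - ζ‖), sq_nonneg (‖z‖ + B)]
      · linarith [abs_nonneg (Real.log ‖z - ζ‖)]
    · filter_upwards [h.ae_ne z] with ζ hζ
      have hpos : 0 < ‖z - ζ‖ := norm_pos_iff.2 hζ
      have h3 : Tendsto (fun n => ‖z - ζ‖ ^ 2 + ε n ^ 2) atTop (𝓝 (‖z - ζ‖ ^ 2)) := by
        simpa using (hε0.pow 2).const_add (‖z - ζ‖ ^ 2)
      have h4 := (h3.log (by positivity)).div_const 2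
      rw [Real.log_pow] at h4
      simpa [smoothLog] using h4
  have hcont := continuous_laplacian hφ2
  have hleft : Tendsto (fun n => ∫ z, (∫ ζ, smoothLog (ε n) (z - ζ) ∂ν) *
      Laplacian.laplacian φ z) atTop (𝓝 (∫ z, u z * Laplacian.laplacian φ z)) := by
    refine tendsto_integral_of_dominated_convergence
      (fun z => (|u z| + (‖z‖ + B) ^ 2) * |Laplacian.laplacian φ z|) (fun n => ?_) ?_
      (fun n => Eventually.of_forall fun z => ?_)
      (Eventually.of_forall fun z => (hlim z).mul_const _)
    · refine AEStronglyMeasurable.mul ?_ hcont.aestronglyMeasurable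
      refine StronglyMeasurable.aestronglyMeasurable ?_
      refine StronglyMeasurable.integral_prod_right
        (f := fun (z ζ : ℂ) => smoothLog (ε n) (z - ζ)) ?_
      exact ((continuous_smoothLog (hε n)).comp
        (continuous_fst.sub continuous_snd)).stronglyMeasurable
    · refine Continuous.integrable_of_hasCompactSupport (by fun_prop) ?_
      exact (hasCompactSupport_laplacian hφ2 hc).abs.mul_left
    · rw [norm_mul, Real.norm_eq_abs, Real.norm_eq_abs]
      refine mul_le_mul_of_nonneg_right (abs_le.2 ⟨?_, ?_⟩) (abs_nonneg _)
      -- The smoothed potentials lie between `u z` and `(‖z‖ + B) ^ 2`, which gives a bound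
      -- independent of `n`.
      · have := integral_mono_ae (h.integrable z)
          (integrable_smoothLog hB (hε n) (hε1 n) z) (hlow n z)
        rw [h.integral_eq] at this
        linarith [neg_abs_le (u z), sq_nonneg (‖z‖ + B)]
      · have := integral_mono_ae (integrable_smoothLog hB (hε n) (hε1 n) z)
          (integrable_const ((‖z‖ + B) ^ 2)) (hup n z)
        simp only [integral_const, probReal_univ, smul_eq_mul, one_mul] at this
        linarith [abs_nonneg (u z)]
  have hright := tendsto_integral_cauchyKernel (ν := ν) hφ2.continuous hc hε0
  simp_rw [integral_integral_smoothLog hB (hε _) (hε1 _) hφ2 hc] at hleft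
  rw [tendsto_nhds_unique hleft hright]
  have := Real.pi_pos
  field_simp

end HasLogPotential

/-! ### Pull-back under a quadratic map -/

/-- Pull-back of a measure under `z ↦ z ^ 2 + c`, normalized to preserve the total mass. -/
noncomputable def quadPullback (c : ℂ) (ν : Measure ℂ) : Measure ℂ :=
  (2⁻¹ : ENNReal) • (ν.map (fun w => (w - c) ^ ((2 : ℕ) : ℂ)⁻¹) +
    ν.map (fun w => -(w - c) ^ ((2 : ℕ) : ℂ)⁻¹))

section quadPullback

variable {c : ℂ} {ν : Measure ℂ} {u : ℂ → ℝ}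

theorem measurable_quadRoot (c : ℂ) : Measurable fun w : ℂ => (w - c) ^ ((2 : ℕ) : ℂ)⁻¹ :=
  (measurable_id.sub_const c).pow_const _

theorem quadRoot_sq (c w : ℂ) : ((w - c) ^ ((2 : ℕ) : ℂ)⁻¹) ^ 2 = w - c :=
  Complex.cpow_nat_inv_pow _ two_ne_zero

instance isProbabilityMeasure_quadPullback [IsProbabilityMeasure ν] :
    IsProbabilityMeasure (quadPullback c ν) := by
  constructor
  have h1 := measurable_quadRoot c
  simp only [quadPullback, Measure.smul_apply, Measure.add_apply]
  rw [Measure.map_apply h1 .univ, Measure.map_apply h1.fun_neg .univ]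
  simp [one_add_one_eq_two, ENNReal.inv_mul_cancel]

theorem ae_quadPullback {p : ℂ → Prop} (hp : MeasurableSet {w | p w})
    (h : ∀ᵐ w ∂ν, p ((w - c) ^ ((2 : ℕ) : ℂ)⁻¹) ∧ p (-(w - c) ^ ((2 : ℕ) : ℂ)⁻¹)) :
    ∀ᵐ z ∂(quadPullback c ν), p z := by
  have h1 := measurable_quadRoot c
  refine Measure.ae_smul_measure ?_ _
  rw [ae_add_measure_iff, ae_map_iff h1.aemeasurable hp, ae_map_iff h1.fun_neg.aemeasurable hp]
  exact ⟨h.mono fun _ h => h.1, h.mono fun _ h => h.2⟩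

/-- Both branches of the root are sections of `z ↦ z ^ 2 + c`, so that map carries the pull-back to
`ν`. -/
theorem ae_quadPullback_comp {p : ℂ → Prop} (hp : MeasurableSet {w | p w})
    (h : ∀ᵐ w ∂ν, p w) : ∀ᵐ z ∂(quadPullback c ν), p (z ^ 2 + c) := by
  have hm : Measurable fun z : ℂ => z ^ 2 + c := by fun_prop
  refine ae_quadPullback (p := fun z => p (z ^ 2 + c)) (hm hp) ?_
  filter_upwards [h] with w hw
  rw [neg_sq, quadRoot_sq, sub_add_cancel]
  exact ⟨hw, hw⟩

/-- If `s ^ 2 = w - c`, then `(z - s) * (z + s) = z ^ 2 + c - w`: the kernels at the two preimages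
of `w` add up to the kernel at `z ^ 2 + c`. -/
theorem HasLogPotential.quadPullback [IsProbabilityMeasure ν] (h : HasLogPotential ν u) (c : ℂ) :
    HasLogPotential (quadPullback c ν) fun z => u (z ^ 2 + c) / 2 := by
  obtain ⟨B, hB⟩ := h.exists_bound
  have h1 := measurable_quadRoot c
  have hs : ∀ᵐ w ∂ν, ‖(w - c) ^ ((2 : ℕ) : ℂ)⁻¹‖ ≤ B + ‖c‖ + 1 := by
    filter_upwards [hB] with w hw
    have h2 := congrArg norm (quadRoot_sq c w)
    rw [norm_pow] at h2
    have h3 := norm_sub_le w c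
    nlinarith [sq_nonneg (‖(w - c) ^ ((2 : ℕ) : ℂ)⁻¹‖ - 1), norm_nonneg w]
  have hadd : ∀ z, ∀ᵐ w ∂ν, Real.log ‖z - (w - c) ^ ((2 : ℕ) : ℂ)⁻¹‖ +
      Real.log ‖z - -(w - c) ^ ((2 : ℕ) : ℂ)⁻¹‖ = Real.log ‖z ^ 2 + c - w‖ := fun z => by
    filter_upwards [h.ae_ne (z ^ 2 + c)] with w hw
    have h2 := quadRoot_sq c w
    have h3 : (z - (w - c) ^ ((2 : ℕ) : ℂ)⁻¹) * (z - -(w - c) ^ ((2 : ℕ) : ℂ)⁻¹) =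
        z ^ 2 + c - w := by linear_combination -h2
    rw [← h3, mul_ne_zero_iff] at hw
    rw [← h3, norm_mul, Real.log_mul (norm_ne_zero_iff.2 hw.1) (norm_ne_zero_iff.2 hw.2)]
  have hm : ∀ z, Measurable fun ζ : ℂ => Real.log ‖z - ζ‖ := fun z => by fun_prop
  have hint : ∀ z, Integrable (fun w => Real.log ‖z - (w - c) ^ ((2 : ℕ) : ℂ)⁻¹‖) ν ∧
      Integrable (fun w => Real.log ‖z - -(w - c) ^ ((2 : ℕ) : ℂ)⁻¹‖) ν := fun z => by
    -- Integrability of the sum has to be split. Each summand is bounded above because the roots are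
    -- bounded, so each is also at least the sum minus that bound.
    have hi := ((h.integrable (z ^ 2 + c)).abs.add
      (integrable_const (2 * (‖z‖ + (B + ‖c‖ + 1)))))
    have hbd : ∀ᵐ w ∂ν, |Real.log ‖z - (w - c) ^ ((2 : ℕ) : ℂ)⁻¹‖| ≤
        |Real.log ‖z ^ 2 + c - w‖| + 2 * (‖z‖ + (B + ‖c‖ + 1)) ∧
        |Real.log ‖z - -(w - c) ^ ((2 : ℕ) : ℂ)⁻¹‖| ≤
        |Real.log ‖z ^ 2 + c - w‖| + 2 * (‖z‖ + (B + ‖c‖ + 1)) := by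
      filter_upwards [hs, hadd z] with w h2 h3
      have h4 : Real.log ‖z - (w - c) ^ ((2 : ℕ) : ℂ)⁻¹‖ ≤ ‖z‖ + (B + ‖c‖ + 1) :=
        (Real.log_le_self (norm_nonneg _)).trans ((norm_sub_le _ _).trans (by gcongr))
      have h5 : Real.log ‖z - -(w - c) ^ ((2 : ℕ) : ℂ)⁻¹‖ ≤ ‖z‖ + (B + ‖c‖ + 1) :=
        (Real.log_le_self (norm_nonneg _)).trans ((norm_sub_le _ _).trans (by
          rw [norm_neg]; gcongr))
      have h6 := neg_abs_le (Real.log ‖z ^ 2 + c - w‖)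
      have h7 := abs_nonneg (Real.log ‖z ^ 2 + c - w‖)
      have h8 := (norm_nonneg _).trans h2
      have h9 := norm_nonneg z
      constructor <;> rw [abs_le] <;> constructor <;> linarith
    exact ⟨Integrable.mono' hi ((hm z).comp h1).aestronglyMeasurable (hbd.mono fun _ h => h.1),
      Integrable.mono' hi ((hm z).comp h1.fun_neg).aestronglyMeasurable (hbd.mono fun _ h => h.2)⟩
  have hmap : ∀ z, Integrable (fun ζ => Real.log ‖z - ζ‖)
        (ν.map fun w => (w - c) ^ ((2 : ℕ) : ℂ)⁻¹) ∧
      Integrable (fun ζ => Real.log ‖z - ζ‖) (ν.map fun w => -(w - c) ^ ((2 : ℕ) : ℂ)⁻¹) :=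
    fun z => ⟨(integrable_map_measure (hm z).aestronglyMeasurable h1.aemeasurable).2 (hint z).1,
      (integrable_map_measure (hm z).aestronglyMeasurable h1.fun_neg.aemeasurable).2 (hint z).2⟩
  refine ⟨⟨B + ‖c‖ + 1, ?_⟩, fun z => ?_, fun z => ?_, fun z => ?_⟩
  · refine ae_quadPullback (measurableSet_le measurable_norm measurable_const) ?_
    filter_upwards [hs] with w hw using ⟨hw, by rwa [norm_neg]⟩
  · refine measure_eq_zero_iff_ae_notMem.2 (ae_quadPullback (measurableSet_singleton z).compl ?_)
    filter_upwards [h.ae_ne (z ^ 2 + c)] with w hw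
    have h2 := quadRoot_sq c w
    constructor <;> rintro h3 <;> refine hw ?_ <;> rw [← (h3 : _ = z)]
    · linear_combination h2
    · linear_combination h2
  · exact ((hmap z).1.add_measure (hmap z).2).smul_measure (by simp)
  · rw [_root_.quadPullback, integral_smul_measure, integral_add_measure (hmap z).1 (hmap z).2,
      integral_map h1.aemeasurable (hm z).aestronglyMeasurable,
      integral_map h1.fun_neg.aemeasurable (hm z).aestronglyMeasurable,
      ← integral_add (hint z).1 (hint z).2, integral_congr_ae (hadd z), h.integral_eq]
    simp; ring

end quadPullback

/-! ### The unit circle and iterated pull-backs -/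

/-- The normalized arc length on the unit circle. -/
noncomputable def unitCircleMeasure : Measure ℂ :=
  (ENNReal.ofReal (2 * π))⁻¹ • (volume.restrict (Ioc 0 (2 * π))).map (circleMap 0 1)

instance isProbabilityMeasure_unitCircleMeasure : IsProbabilityMeasure unitCircleMeasure := by
  constructor
  rw [unitCircleMeasure, Measure.smul_apply,
    Measure.map_apply (continuous_circleMap 0 1).measurable .univ]
  simp only [preimage_univ, Measure.restrict_apply_univ, Real.volume_Ioc, sub_zero, smul_eq_mul]
  exact ENNReal.inv_mul_cancel (by simp [Real.pi_pos]) ENNReal.ofReal_ne_top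

theorem ae_unitCircleMeasure : ∀ᵐ ζ ∂unitCircleMeasure, ‖ζ‖ = 1 := by
  refine Measure.ae_smul_measure ?_ _
  rw [ae_map_iff (continuous_circleMap 0 1).measurable.aemeasurable
    (measurableSet_eq_fun measurable_norm measurable_const)]
  simp

theorem hasLogPotential_unitCircleMeasure :
    HasLogPotential unitCircleMeasure fun z => log⁺ ‖z‖ := by
  have h1 := (continuous_circleMap 0 1).measurable
  have hm : ∀ z, Measurable fun ζ : ℂ => Real.log ‖z - ζ‖ := fun z => by fun_prop
  refine ⟨⟨1, ae_unitCircleMeasure.mono fun _ h => h.le⟩, fun z => ?_, fun z => ?_, fun z => ?_⟩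
  · rw [unitCircleMeasure, Measure.smul_apply, Measure.map_apply h1 (measurableSet_singleton z),
      smul_eq_mul]
    have : volume.restrict (Ioc 0 (2 * π)) (circleMap 0 1 ⁻¹' {z}) = 0 :=
      ((countable_singleton z).preimage_circleMap 0 one_ne_zero).measure_zero _
    rw [this, mul_zero]
  · refine Integrable.smul_measure ?_ (by simp [Real.pi_pos])
    rw [integrable_map_measure (hm z).aestronglyMeasurable h1.aemeasurable]
    have := (circleIntegrable_log_norm_sub_const (a := z) (c := 0) 1).1
    simpa only [IntegrableOn, Function.comp_def, norm_sub_rev z] using this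
  · rw [unitCircleMeasure, integral_smul_measure,
      integral_map h1.aemeasurable (hm z).aestronglyMeasurable,
      ← circleAverage_log_norm_sub_const_eq_posLog, circleAverage_def,
      intervalIntegral.integral_of_le (by positivity)]
    simp_rw [norm_sub_rev z]
    rw [ENNReal.toReal_inv, ENNReal.toReal_ofReal (by positivity)]

/-- The composition `Q_{n-1} ∘ ⋯ ∘ Q_0` of the quadratic maps `Q_k(z) = z ^ 2 + c k`. -/
def quadIter (c : ℕ → ℂ) : ℕ → ℂ → ℂ
  | 0, z => z
  | n + 1, z => quadIter c n z ^ 2 + c n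

/-- The iterated pull-back of a measure under the compositions of quadratic maps. -/
noncomputable def iterPullback (c : ℕ → ℂ) : ℕ → Measure ℂ → Measure ℂ
  | 0, ν => ν
  | n + 1, ν => iterPullback c n (quadPullback (c n) ν)

theorem isProbabilityMeasure_iterPullback (c : ℕ → ℂ) (n : ℕ) (ν : Measure ℂ)
    [IsProbabilityMeasure ν] : IsProbabilityMeasure (iterPullback c n ν) := by
  induction n generalizing ν with
  | zero => assumption
  | succ n ih => exact ih _

/-- The outermost map is undone first, so the induction must leave `ν` and `u` general. -/
theorem HasLogPotential.iterPullback {ν : Measure ℂ} {u : ℂ → ℝ} [IsProbabilityMeasure ν]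
    (h : HasLogPotential ν u) (c : ℕ → ℂ) (n : ℕ) :
    HasLogPotential (iterPullback c n ν) fun z => u (quadIter c n z) / 2 ^ n := by
  induction n generalizing ν u with
  | zero => simpa [_root_.iterPullback, quadIter] using h
  | succ n ih =>
    have := ih (h.quadPullback (c n))
    simpa only [_root_.iterPullback, quadIter, div_div, ← pow_succ'] using this

theorem ae_iterPullback {ν : Measure ℂ} {p : ℂ → Prop} (hp : MeasurableSet {w | p w})
    (h : ∀ᵐ w ∂ν, p w) (c : ℕ → ℂ) (n : ℕ) : ∀ᵐ z ∂(iterPullback c n ν), p (quadIter c n z) := by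
  induction n generalizing ν p with
  | zero => exact h
  | succ n ih =>
    have hm : Measurable fun z : ℂ => z ^ 2 + c n := by fun_prop
    exact ih (p := fun z => p (z ^ 2 + c n)) (hm hp) (ae_quadPullback_comp hp h)

theorem continuous_quadIter (c : ℕ → ℂ) (n : ℕ) : Continuous (quadIter c n) := by
  induction n with
  | zero => exact continuous_id
  | succ n ih => exact (ih.pow 2).add continuous_const

/-! ### Jensen's formula and weak limits of potentials -/

/-- The logarithmic kernel truncated from below at `log r`. -/
noncomputable def truncLog (r : ℝ) (w : ℂ) : ℝ := Real.log r + log⁺ (r⁻¹ * ‖w‖)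

/-- The `log⁺` form is what the circle average of the kernel produces; this form shows continuity
and the bounds. -/
theorem truncLog_eq {r : ℝ} (hr : 0 < r) (w : ℂ) : truncLog r w = Real.log (max r ‖w‖) := by
  unfold truncLog
  rcases le_total ‖w‖ r with h | h
  · rw [max_eq_left h, (posLog_eq_zero_iff _).2, add_zero]
    rw [abs_of_nonneg (by positivity)]
    exact (inv_mul_le_one₀ hr).2 h
  · rw [max_eq_right h, posLog_eq_log, Real.log_mul (inv_ne_zero hr.ne') (hr.trans_le h).ne',
      Real.log_inv]
    · ring
    · rw [abs_of_nonneg (by positivity)]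
      exact (one_le_inv_mul₀ hr).2 h

theorem continuous_truncLog {r : ℝ} (hr : 0 < r) : Continuous (truncLog r) := by
  rw [show truncLog r = fun w => Real.log (max r ‖w‖) from funext (truncLog_eq hr)]
  exact Continuous.log (by fun_prop) fun w => (lt_max_of_lt_left hr).ne'

theorem truncLog_le {r : ℝ} (hr : 0 < r) (h1 : r ≤ 1) (w : ℂ) : truncLog r w ≤ ‖w‖ := by
  rw [truncLog_eq hr]
  rcases le_total ‖w‖ r with h | h
  · rw [max_eq_left h]
    exact (Real.log_nonpos hr.le h1).trans (norm_nonneg w)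
  · rw [max_eq_right h]
    exact Real.log_le_self (norm_nonneg w)

theorem log_le_truncLog {r : ℝ} (hr : 0 < r) (w : ℂ) : Real.log r ≤ truncLog r w := by
  rw [truncLog_eq hr]
  exact Real.log_le_log hr (le_max_left _ _)

theorem tendsto_truncLog {w : ℂ} (hw : w ≠ 0) {r : ℕ → ℝ} (hr : ∀ n, 0 < r n)
    (h0 : Tendsto r atTop (𝓝 0)) :
    Tendsto (fun n => truncLog (r n) w) atTop (𝓝 (Real.log ‖w‖)) := by
  have hpos : 0 < ‖w‖ := norm_pos_iff.2 hw
  simp_rw [truncLog_eq (hr _)]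
  have h1 : Tendsto (fun n => max (r n) ‖w‖) atTop (𝓝 (max 0 ‖w‖)) := h0.max tendsto_const_nhds
  rw [max_eq_right hpos.le] at h1
  exact h1.log hpos.ne'

/-- Jensen's formula for logarithmic potentials. -/
theorem HasLogPotential.circleAverage_eq {ν : Measure ℂ} {u : ℂ → ℝ} [IsProbabilityMeasure ν]
    (h : HasLogPotential ν u) (hu : Continuous u) (z : ℂ) {r : ℝ} (hr : 0 < r) :
    circleAverage u z r = ∫ ζ, truncLog r (z - ζ) ∂ν := by
  obtain ⟨B, hB⟩ := h.exists_bound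
  have hcm := continuous_circleMap z r
  have hm : StronglyMeasurable fun p : ℝ × ℂ => Real.log ‖circleMap z r p.1 - p.2‖ := by
    refine Measurable.stronglyMeasurable ?_
    have : Continuous fun p : ℝ × ℂ => circleMap z r p.1 - p.2 :=
      (hcm.comp continuous_fst).sub continuous_snd
    exact Real.measurable_log.comp this.norm.measurable
  have hnorm : ∀ θ, ‖circleMap z r θ‖ ≤ ‖z‖ + r := fun θ => by
    have : circleMap z r θ = z + (circleMap z r θ - z) := by ring
    rw [this]
    refine (norm_add_le _ _).trans ?_
    rw [circleMap_sub_center, norm_circleMap_zero, abs_of_pos hr]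
  -- If `k ≤ C` and `0 ≤ C`, then `|k| ≤ 2 * C - k`. Integrating gives a bound continuous in `θ`,
  -- which is what Fubini needs.
  have hbd : ∀ θ, ∫ ζ, ‖Real.log ‖circleMap z r θ - ζ‖‖ ∂ν ≤
      2 * (‖z‖ + r + |B|) - u (circleMap z r θ) := fun θ => by
    rw [← h.integral_eq, ← show ∫ _, 2 * (‖z‖ + r + |B|) ∂ν = 2 * (‖z‖ + r + |B|) by simp,
      ← integral_sub (integrable_const _) (h.integrable _)]
    refine integral_mono_ae (h.integrable _).norm
      ((integrable_const _).sub (h.integrable _)) ?_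
    filter_upwards [hB] with ζ hζ
    have h1 : Real.log ‖circleMap z r θ - ζ‖ ≤ ‖z‖ + r + |B| :=
      (Real.log_le_self (norm_nonneg _)).trans ((norm_sub_le _ _).trans
        (add_le_add (hnorm θ) (hζ.trans (le_abs_self B))))
    have h2 : 0 ≤ ‖z‖ + r + |B| := by positivity
    rw [Real.norm_eq_abs]
    exact abs_le.2 ⟨by linarith, by linarith⟩
  have hint : Integrable (Function.uncurry fun (θ : ℝ) (ζ : ℂ) =>
      Real.log ‖circleMap z r θ - ζ‖) ((volume.restrict (Ioc 0 (2 * π))).prod ν) := by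
    have hm' : AEStronglyMeasurable (Function.uncurry fun (θ : ℝ) (ζ : ℂ) =>
        Real.log ‖circleMap z r θ - ζ‖) ((volume.restrict (Ioc 0 (2 * π))).prod ν) :=
      hm.aestronglyMeasurable
    rw [integrable_prod_iff hm']
    refine ⟨Eventually.of_forall fun θ => h.integrable (circleMap z r θ), ?_⟩
    have hcu : Continuous fun θ => 2 * (‖z‖ + r + |B|) - u (circleMap z r θ) := by fun_prop
    refine Integrable.mono' (hcu.integrableOn_Ioc) ?_ (Eventually.of_forall fun θ => ?_)
    · exact (StronglyMeasurable.integral_prod_right' hm.norm).aestronglyMeasurable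
    · rw [Real.norm_of_nonneg (integral_nonneg fun _ => norm_nonneg _)]
      exact hbd θ
  rw [circleAverage_def, intervalIntegral.integral_of_le (by positivity)]
  simp_rw [← h.integral_eq]
  rw [integral_integral_swap hint, ← integral_smul]
  congr 1
  ext ζ
  rw [← intervalIntegral.integral_of_le (by positivity)]
  exact circleAverage_log_norm_sub_const_eq_log_radius_add_posLog hr.ne'

theorem tendsto_circleAverage_of_tendstoUniformly {ι : Type*} {L : Filter ι} {u : ι → ℂ → ℝ}
    {g : ℂ → ℝ} (hu : ∀ i, Continuous (u i)) (hg : Continuous g) (h : TendstoUniformly u g L)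
    (z : ℂ) (r : ℝ) :
    Tendsto (fun i => circleAverage (u i) z r) L (𝓝 (circleAverage g z r)) := by
  have hcm := continuous_circleMap z r
  rw [Metric.tendstoUniformly_iff] at h
  rw [Metric.tendsto_nhds]
  intro ε hε
  filter_upwards [h (ε / 2) (half_pos hε)] with i hi
  simp only [circleAverage_def, dist_eq_norm, ← smul_sub]
  have h1 : Continuous fun θ => u i (circleMap z r θ) := (hu i).comp hcm
  have h2 : Continuous fun θ => g (circleMap z r θ) := hg.comp hcm
  rw [← intervalIntegral.integral_sub (h1.intervalIntegrable _ _) (h2.intervalIntegrable _ _)]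
  have := intervalIntegral.norm_integral_le_of_norm_le_const (a := 0) (b := 2 * π) (C := ε / 2)
    (f := fun θ => u i (circleMap z r θ) - g (circleMap z r θ)) fun θ _ => by
      rw [← dist_eq_norm, dist_comm]; exact (hi _).le
  rw [norm_smul, Real.norm_of_nonneg (by positivity), inv_mul_lt_iff₀ (by positivity)]
  rw [sub_zero, abs_of_pos (by positivity)] at this
  refine this.trans_lt ?_
  have := Real.pi_pos
  nlinarith

theorem tendsto_circleAverage_zero {g : ℂ → ℝ} (hg : Continuous g) (z : ℂ) {r : ℕ → ℝ}
    (hr : Tendsto r atTop (𝓝 0)) :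
    Tendsto (fun n => circleAverage g z (r n)) atTop (𝓝 (g z)) := by
  have h : Continuous fun s => circleAverage g z s := by
    simp only [circleAverage_def]
    have h1 : Continuous (Function.uncurry fun s θ => g (circleMap z s θ)) := by
      unfold circleMap Function.uncurry
      fun_prop
    exact continuous_const.mul
      (intervalIntegral.continuous_parametric_intervalIntegral_of_continuous'
        (μ := volume) h1 0 (2 * π))
  simpa [Function.comp_def] using (h.tendsto 0).comp hr

/-- A weak limit of measures supported in a fixed disc is supported in that disc. -/
theorem ae_norm_le_of_tendsto {ι : Type*} {L : Filter ι} [L.NeBot] {ν : ι → ProbabilityMeasure ℂ}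
    {μ : ProbabilityMeasure ℂ} (h : Tendsto ν L (𝓝 μ)) {B : ℝ}
    (hB : ∀ i, ∀ᵐ ζ ∂(ν i : Measure ℂ), ‖ζ‖ ≤ B) : ∀ᵐ ζ ∂(μ : Measure ℂ), ‖ζ‖ ≤ B := by
  have ho : IsOpen {ζ : ℂ | ¬ ‖ζ‖ ≤ B} := by
    simpa only [not_le] using isOpen_lt continuous_const continuous_norm
  have := ProbabilityMeasure.le_liminf_measure_open_of_tendsto h ho
  have h0 : ∀ i, (ν i : Measure ℂ) {ζ : ℂ | ¬ ‖ζ‖ ≤ B} = 0 := fun i => ae_iff.1 (hB i)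
  simp only [h0, liminf_const] at this
  exact ae_iff.2 (le_zero_iff.1 this)

/-- The truncated kernel is continuous but unbounded at infinity. Capping it at `C` makes it a
bounded test function without changing it on the disc that carries all the measures. -/
theorem tendsto_integral_truncLog {ι : Type*} {L : Filter ι} [L.NeBot]
    {ν : ι → ProbabilityMeasure ℂ} {μ : ProbabilityMeasure ℂ} (h : Tendsto ν L (𝓝 μ)) {B : ℝ}
    (hB : ∀ i, ∀ᵐ ζ ∂(ν i : Measure ℂ), ‖ζ‖ ≤ B) {r : ℝ} (hr : 0 < r) (z : ℂ) :
    Tendsto (fun i => ∫ ζ, truncLog r (z - ζ) ∂(ν i : Measure ℂ)) L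
      (𝓝 (∫ ζ, truncLog r (z - ζ) ∂(μ : Measure ℂ))) := by
  set C := Real.log (max r (‖z‖ + B)) with hC
  have hk : Continuous fun ζ => truncLog r (z - ζ) :=
    (continuous_truncLog hr).comp (continuous_const.sub continuous_id)
  have hle : ∀ ζ, ‖ζ‖ ≤ B → truncLog r (z - ζ) ≤ C := fun ζ hζ => by
    rw [truncLog_eq hr]
    exact Real.log_le_log (lt_max_of_lt_left hr)
      (max_le_max le_rfl ((norm_sub_le _ _).trans (by gcongr)))
  let f : BoundedContinuousFunction ℂ ℝ := BoundedContinuousFunction.ofNormedAddCommGroup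
    (fun ζ => min (truncLog r (z - ζ)) C) (by fun_prop) (|Real.log r| + |C|) fun ζ => by
      have h1 := log_le_truncLog hr (z - ζ)
      have h2 := neg_abs_le (Real.log r)
      have h3 := neg_abs_le C
      have h4 := abs_nonneg (Real.log r)
      have h5 := abs_nonneg C
      have h6 := le_abs_self C
      rw [Real.norm_eq_abs, abs_le]
      exact ⟨le_min (by linarith) (by linarith), (min_le_right _ _).trans (by linarith)⟩
  have key : ∀ ν : Measure ℂ, (∀ᵐ ζ ∂ν, ‖ζ‖ ≤ B) →
      ∫ ζ, f ζ ∂ν = ∫ ζ, truncLog r (z - ζ) ∂ν := fun ν hν => by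
    refine integral_congr_ae ?_
    filter_upwards [hν] with ζ hζ using min_eq_left (hle ζ hζ)
  have := ProbabilityMeasure.tendsto_iff_forall_integral_tendsto.1 h f
  rw [key _ (ae_norm_le_of_tendsto h hB)] at this
  exact this.congr fun i => key _ (hB i)

/-- If the truncated potentials of `μ` are the circle averages of a continuous function, then
this function is the potential of `μ`. -/
theorem HasLogPotential.of_circleAverage {μ : Measure ℂ} [IsProbabilityMeasure μ] {g : ℂ → ℝ}
    (hg : Continuous g) (hbd : ∃ B, ∀ᵐ ζ ∂μ, ‖ζ‖ ≤ B)
    (h : ∀ z r, 0 < r → circleAverage g z r = ∫ ζ, truncLog r (z - ζ) ∂μ) :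
    HasLogPotential μ g := by
  obtain ⟨B, hB⟩ := hbd
  set r : ℕ → ℝ := fun n => 1 / ((n : ℝ) + 1) with hrdef
  have hr0 : Tendsto r atTop (𝓝 0) := tendsto_one_div_add_atTop_nhds_zero_nat
  have hr : ∀ n, 0 < r n := fun n => by positivity
  have hr1 : ∀ n, r n ≤ 1 := fun n => by
    rw [hrdef]; exact (div_le_one (by positivity)).2 (by linarith [n.cast_nonneg (α := ℝ)])
  have hk : ∀ n z, Continuous fun ζ => truncLog (r n) (z - ζ) := fun n z =>
    (continuous_truncLog (hr n)).comp (continuous_const.sub continuous_id)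
  have hup : ∀ n z, ∀ᵐ ζ ∂μ, truncLog (r n) (z - ζ) ≤ ‖z‖ + |B| := fun n z => by
    filter_upwards [hB] with ζ hζ
    exact (truncLog_le (hr n) (hr1 n) _).trans ((norm_sub_le _ _).trans
      (by gcongr; exact hζ.trans (le_abs_self B)))
  have hint : ∀ n z, Integrable (fun ζ => truncLog (r n) (z - ζ)) μ := fun n z => by
    refine Integrable.mono' (integrable_const (|Real.log (r n)| + (‖z‖ + |B|)))
      (hk n z).aestronglyMeasurable ?_
    filter_upwards [hup n z] with ζ hζ
    have h1 := log_le_truncLog (hr n) (z - ζ)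
    have h2 := neg_abs_le (Real.log (r n))
    have h3 := abs_nonneg (Real.log (r n))
    have h4 : 0 ≤ ‖z‖ + |B| := by positivity
    rw [Real.norm_eq_abs, abs_le]
    constructor <;> linarith
  have hconv : ∀ z, Tendsto (fun n => ∫ ζ, truncLog (r n) (z - ζ) ∂μ) atTop (𝓝 (g z)) :=
    fun z => (tendsto_circleAverage_zero hg z hr0).congr fun n => h z _ (hr n)
  -- An atom at `z` would contribute `μ {z} * log (r n)` and drive the truncated potentials to `-∞`,
  -- whereas they converge to `g z`.
  have hatom : ∀ z, μ {z} = 0 := fun z => by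
    by_contra hne
    have hpos : 0 < μ.real {z} := ENNReal.toReal_pos hne (measure_ne_top _ _)
    have hle : ∀ n, ∫ ζ, truncLog (r n) (z - ζ) ∂μ ≤
        (‖z‖ + |B|) + μ.real {z} * Real.log (r n) := fun n => by
      have h1 : Integrable (({z} : Set ℂ).indicator fun _ => Real.log (r n)) μ :=
        (integrable_const _).indicator (measurableSet_singleton z)
      have h2 : ∫ ζ, ((‖z‖ + |B|) + ({z} : Set ℂ).indicator (fun _ => Real.log (r n)) ζ) ∂μ =
          (‖z‖ + |B|) + μ.real {z} * Real.log (r n) := by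
        rw [integral_add (integrable_const _) h1, integral_indicator (measurableSet_singleton z)]
        simp [Measure.real]
      rw [← h2]
      refine integral_mono_ae (hint n z) ((integrable_const _).add h1) ?_
      filter_upwards [hup n z] with ζ hζ
      by_cases hz : ζ = z
      · subst hz
        have : 0 ≤ ‖ζ‖ + |B| := by positivity
        simp [truncLog] at this ⊢
        exact this
      · simpa [hz] using hζ
    have hlog : Tendsto (fun n => (‖z‖ + |B|) + μ.real {z} * Real.log (r n)) atTop atBot := by
      refine tendsto_atBot_add_const_left _ _ (Tendsto.const_mul_atBot hpos ?_)
      refine Real.tendsto_log_nhdsGT_zero.comp (tendsto_nhdsWithin_iff.2 ⟨hr0, ?_⟩)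
      exact Eventually.of_forall hr
    exact not_tendsto_nhds_of_tendsto_atBot (tendsto_atBot_mono hle hlog) _ (hconv z)
  have hne : ∀ z, ∀ᵐ ζ ∂μ, z - ζ ≠ 0 := fun z => by
    filter_upwards [measure_eq_zero_iff_ae_notMem.1 (hatom z)] with ζ hζ h0
    exact hζ (sub_eq_zero.1 h0).symm
  have hlim : ∀ z, ∀ᵐ ζ ∂μ, Tendsto (fun n => truncLog (r n) (z - ζ)) atTop
      (𝓝 (Real.log ‖z - ζ‖)) := fun z => by
    filter_upwards [hne z] with ζ hζ using tendsto_truncLog hζ hr hr0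
  have hlogup : ∀ z, ∀ᵐ ζ ∂μ, Real.log ‖z - ζ‖ ≤ ‖z‖ + |B| := fun z => by
    filter_upwards [hB] with ζ hζ
    exact (Real.log_le_self (norm_nonneg _)).trans ((norm_sub_le _ _).trans
      (by gcongr; exact hζ.trans (le_abs_self B)))
  -- Fatou's lemma for the nonnegative functions `‖z‖ + |B| - truncLog (r n) (z - ζ)`, whose
  -- integrals converge.
  have hli : ∀ z, Integrable (fun ζ => Real.log ‖z - ζ‖) μ := fun z => by
    have hm : Measurable fun ζ : ℂ => Real.log ‖z - ζ‖ := by fun_prop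
    suffices Integrable (fun ζ => (‖z‖ + |B|) - Real.log ‖z - ζ‖) μ by
      refine ((integrable_const (‖z‖ + |B|)).sub this).congr (Eventually.of_forall fun ζ => ?_)
      simp
    refine ⟨(measurable_const.sub hm).aestronglyMeasurable, ?_⟩
    rw [hasFiniteIntegral_iff_ofReal
      ((hlogup z).mono fun ζ hζ => sub_nonneg.2 hζ)]
    have hF := lintegral_liminf_le (μ := μ) (u := atTop)
      (f := fun n ζ => ENNReal.ofReal ((‖z‖ + |B|) - truncLog (r n) (z - ζ)))
      fun n => by
        have := (hk n z).measurable
        fun_prop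
    have h1 : ∀ᵐ ζ ∂μ, liminf (fun n => ENNReal.ofReal ((‖z‖ + |B|) - truncLog (r n) (z - ζ)))
        atTop = ENNReal.ofReal ((‖z‖ + |B|) - Real.log ‖z - ζ‖) := by
      filter_upwards [hlim z] with ζ hζ
      exact (ENNReal.tendsto_ofReal (hζ.const_sub _)).liminf_eq
    rw [lintegral_congr_ae h1] at hF
    refine hF.trans_lt ?_
    have h2 : ∀ n, ∫⁻ ζ, ENNReal.ofReal ((‖z‖ + |B|) - truncLog (r n) (z - ζ)) ∂μ =
        ENNReal.ofReal ((‖z‖ + |B|) - ∫ ζ, truncLog (r n) (z - ζ) ∂μ) := fun n => by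
      have h3 : Integrable (fun ζ => (‖z‖ + |B|) - truncLog (r n) (z - ζ)) μ :=
        (integrable_const _).sub (hint n z)
      rw [← ofReal_integral_eq_lintegral_ofReal h3
        ((hup n z).mono fun ζ hζ => sub_nonneg.2 hζ),
        integral_sub (integrable_const _) (hint n z)]
      simp
    simp_rw [h2]
    rw [(ENNReal.tendsto_ofReal ((hconv z).const_sub _)).liminf_eq]
    exact ENNReal.ofReal_lt_top
  refine ⟨⟨B, hB⟩, hatom, hli, fun z => ?_⟩
  refine tendsto_nhds_unique ?_ (hconv z)
  refine tendsto_integral_of_dominated_convergence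
    (fun ζ => |Real.log ‖z - ζ‖| + (‖z‖ + |B|)) (fun n => (hk n z).aestronglyMeasurable)
    ((hli z).abs.add (integrable_const _)) (fun n => ?_) (hlim z)
  filter_upwards [hup n z, hne z] with ζ h1 h2
  have h3 : Real.log ‖z - ζ‖ ≤ truncLog (r n) (z - ζ) := by
    rw [truncLog_eq (hr n)]
    exact Real.log_le_log (norm_pos_iff.2 h2) (le_max_right _ _)
  have h4 := neg_abs_le (Real.log ‖z - ζ‖)
  have h5 := abs_nonneg (Real.log ‖z - ζ‖)
  have h6 : 0 ≤ ‖z‖ + |B| := by positivity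
  rw [Real.norm_eq_abs, abs_le]
  constructor <;> linarith

/-- Logarithmic potentials pass to weak limits when they converge uniformly. -/
theorem HasLogPotential.of_tendsto {ι : Type*} {L : Filter ι} [L.NeBot]
    {ν : ι → ProbabilityMeasure ℂ} {μ : ProbabilityMeasure ℂ} {u : ι → ℂ → ℝ} {g : ℂ → ℝ} {B : ℝ}
    (h : Tendsto ν L (𝓝 μ)) (hB : ∀ i, ∀ᵐ ζ ∂(ν i : Measure ℂ), ‖ζ‖ ≤ B)
    (hν : ∀ i, HasLogPotential (ν i : Measure ℂ) (u i)) (hu : ∀ i, Continuous (u i))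
    (hg : Continuous g) (hug : TendstoUniformly u g L) : HasLogPotential (μ : Measure ℂ) g := by
  refine .of_circleAverage hg ⟨B, ae_norm_le_of_tendsto h hB⟩ fun z r hr => ?_
  refine tendsto_nhds_unique (tendsto_circleAverage_of_tendstoUniformly hu hg hug z r) ?_
  simp_rw [fun i => (hν i).circleAverage_eq (hu i) z hr]
  exact tendsto_integral_truncLog h hB hr z

/-- A sequence of probability measures on a fixed disc has a weak limit point. -/
theorem exists_tendsto_of_ae_norm_le {ν : ℕ → ProbabilityMeasure ℂ} {B : ℝ}
    (hB : ∀ i, ∀ᵐ ζ ∂(ν i : Measure ℂ), ‖ζ‖ ≤ B) :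
    ∃ (μ : ProbabilityMeasure ℂ) (L : Filter ℕ), L.NeBot ∧ L ≤ atTop ∧ Tendsto ν L (𝓝 μ) := by
  have ht : IsTightMeasureSet {((μ : ProbabilityMeasure ℂ) : Measure ℂ) | μ ∈ range ν} := by
    refine isTightMeasureSet_iff_exists_isCompact_measure_compl_le.2 fun ε hε =>
      ⟨Metric.closedBall 0 B, isCompact_closedBall 0 B, ?_⟩
    rintro _ ⟨_, ⟨i, rfl⟩, rfl⟩
    have : (ν i : Measure ℂ) (Metric.closedBall 0 B)ᶜ = 0 := by
      have := ae_iff.1 (hB i)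
      rwa [show (Metric.closedBall (0 : ℂ) B)ᶜ = {ζ | ¬ ‖ζ‖ ≤ B} by ext; simp]
    rw [this]
    exact zero_le
  obtain ⟨μ, -, hμ⟩ := (isCompact_closure_of_isTightMeasureSet ht).exists_mapClusterPt
    (f := atTop) (u := ν) (by
      exact tendsto_principal.2 (Eventually.of_forall fun n => subset_closure ⟨n, rfl⟩))
  -- An ultrafilter finer than `atTop` replaces the choice of a subsequence.
  obtain ⟨U, hU, hUμ⟩ := mapClusterPt_iff_ultrafilter.1 hμ
  exact ⟨μ, U, inferInstance, hU, hUμ⟩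

/-! ### The Green function of a sequence of quadratic maps -/

/-- The Green function of a non-autonomous sequence of quadratic maps. -/
noncomputable def quadGreen (c : ℕ → ℂ) (z : ℂ) : ℝ :=
  limUnder atTop fun n : ℕ => log⁺ ‖quadIter c n z‖ / 2 ^ n

section dynamics

variable {R : ℝ} {c : ℕ → ℂ}

/-- `R + 2` is an escape radius: there `‖z‖ * (‖z‖ - 2) ≥ (R + 2) * R ≥ R`. -/
theorem two_mul_norm_le_norm_sq_add (hR : 0 < R) {a z : ℂ} (ha : ‖a‖ ≤ R) (hz : R + 2 ≤ ‖z‖) :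
    2 * ‖z‖ ≤ ‖z ^ 2 + a‖ := by
  have h1 := norm_sub_le_norm_add (z ^ 2) a
  rw [norm_pow] at h1
  nlinarith

theorem two_pow_mul_le_norm_quadIter (hR : 0 < R) (hc : ∀ n, ‖c n‖ ≤ R) {m : ℕ} {z : ℂ}
    (hz : R + 2 ≤ ‖quadIter c m z‖) (k : ℕ) : 2 ^ k * (R + 2) ≤ ‖quadIter c (m + k) z‖ := by
  induction k with
  | zero => simpa using hz
  | succ k ih =>
    have h1 : R + 2 ≤ ‖quadIter c (m + k) z‖ :=
      (le_mul_of_one_le_left (by linarith) (one_le_pow₀ (by norm_num))).trans ih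
    have h2 := two_mul_norm_le_norm_sq_add hR (hc (m + k)) h1
    rw [← add_assoc, quadIter, pow_succ]
    linarith

theorem norm_le_of_norm_quadIter_le_one (hR : 0 < R) (hc : ∀ n, ‖c n‖ ≤ R) {n : ℕ} {z : ℂ}
    (hz : ‖quadIter c n z‖ ≤ 1) : ‖z‖ ≤ R + 2 := by
  by_contra! h
  have h1 := two_pow_mul_le_norm_quadIter hR hc (m := 0) (z := z) h.le n
  rw [zero_add] at h1
  have h2 : (1 : ℝ) ≤ 2 ^ n := one_le_pow₀ (by norm_num)
  nlinarith

theorem tendsto_quadIter_cobounded (hR : 0 < R) (hc : ∀ n, ‖c n‖ ≤ R) {m : ℕ} {z : ℂ}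
    (hz : R + 2 ≤ ‖quadIter c m z‖) :
    Tendsto (fun n => quadIter c n z) atTop (Bornology.cobounded ℂ) := by
  rw [← tendsto_norm_atTop_iff_cobounded, ← tendsto_add_atTop_iff_nat m]
  refine tendsto_atTop_mono (fun k => ?_)
    ((tendsto_pow_atTop_atTop_of_one_lt one_lt_two).atTop_mul_const (by linarith : 0 < R + 2))
  rw [add_comm k m]
  exact two_pow_mul_le_norm_quadIter hR hc hz k

/-- With `log⁺` in place of `log` the error in doubling is bounded on the whole plane, even where `z
^ 2 + a` vanishes. Hence the normalized iterates form a uniform geometric Cauchy sequence. -/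
theorem abs_posLog_sq_add_sub_le (hR : 0 < R) {a : ℂ} (ha : ‖a‖ ≤ R) (z : ℂ) :
    |log⁺ ‖z ^ 2 + a‖ - 2 * log⁺ ‖z‖| ≤ 2 * Real.log (R + 2) := by
  have hpl : ∀ w : ℂ, log⁺ ‖w‖ = Real.log (max 1 ‖w‖) := fun w =>
    posLog_eq_log_max_one (norm_nonneg w)
  have h2 : 2 * log⁺ ‖z‖ = Real.log (max 1 ‖z‖ ^ 2) := by rw [hpl, Real.log_pow]; norm_num
  have h3 : 2 * Real.log (R + 2) = Real.log ((R + 2) ^ 2) := by rw [Real.log_pow]; norm_num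
  have hz1 : 1 ≤ max 1 ‖z‖ := le_max_left _ _
  have hw1 : 1 ≤ max 1 ‖z ^ 2 + a‖ := le_max_left _ _
  rw [h2, h3, hpl, abs_sub_le_iff, sub_le_iff_le_add, sub_le_iff_le_add,
    ← Real.log_mul (by positivity) (by positivity),
    ← Real.log_mul (by positivity) (by positivity)]
  constructor <;> refine Real.log_le_log (by positivity) ?_
  · have h4 : ‖z ^ 2 + a‖ ≤ ‖z‖ ^ 2 + R := by
      refine (norm_add_le _ _).trans ?_
      rw [norm_pow]
      gcongr
    have h5 : ‖z‖ ^ 2 ≤ max 1 ‖z‖ ^ 2 := by gcongr; exact le_max_right _ _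
    have h6 : 1 ≤ max 1 ‖z‖ ^ 2 := one_le_pow₀ hz1
    have h7 : 1 + R ≤ (R + 2) ^ 2 := by nlinarith
    have h8 := mul_le_mul_of_nonneg_right h7 (zero_le_one.trans h6)
    have h9 := mul_nonneg hR.le (sub_nonneg.2 h6)
    refine max_le ?_ ?_ <;> linarith
  -- Beyond the escape radius `z ^ 2` dominates `a`; inside it `‖z‖ ^ 2` is itself at most `(R + 2)
  -- ^ 2`.
  · rcases le_total (R + 2) ‖z‖ with h | h
    · have h4 := norm_sub_le_norm_add (z ^ 2) a
      rw [norm_pow] at h4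
      have h5 : ‖z ^ 2 + a‖ ≤ max 1 ‖z ^ 2 + a‖ := le_max_right _ _
      rw [max_eq_right (by linarith : 1 ≤ ‖z‖)]
      have h6 : ‖z‖ ^ 2 ≤ 2 * ‖z ^ 2 + a‖ := by nlinarith
      have h7 : 2 ≤ (R + 2) ^ 2 := by nlinarith
      have h8 := mul_le_mul_of_nonneg_right h7 (zero_le_one.trans hw1)
      linarith
    · have h4 : max 1 ‖z‖ ≤ R + 2 := max_le (by linarith) h
      have h5 : max 1 ‖z‖ ^ 2 ≤ (R + 2) ^ 2 := by gcongr
      nlinarith [sq_nonneg (R + 2)]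

theorem dist_posLog_quadIter_succ (hR : 0 < R) (hc : ∀ n, ‖c n‖ ≤ R) (z : ℂ) (n : ℕ) :
    dist (log⁺ ‖quadIter c n z‖ / 2 ^ n) (log⁺ ‖quadIter c (n + 1) z‖ / 2 ^ (n + 1)) ≤
      2 * Real.log (R + 2) / 2 / 2 ^ n := by
  have h := abs_posLog_sq_add_sub_le hR (hc n) (quadIter c n z)
  have h1 : log⁺ ‖quadIter c n z‖ / 2 ^ n - log⁺ ‖quadIter c (n + 1) z‖ / 2 ^ (n + 1) =
      -(log⁺ ‖quadIter c n z ^ 2 + c n‖ - 2 * log⁺ ‖quadIter c n z‖) / 2 / 2 ^ n := by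
    rw [quadIter]; field_simp; ring
  rw [Real.dist_eq, h1, abs_div, abs_div, abs_neg, abs_of_pos (by positivity : (0 : ℝ) < 2 ^ n),
    abs_two]
  gcongr

theorem tendsto_quadGreen (hR : 0 < R) (hc : ∀ n, ‖c n‖ ≤ R) (z : ℂ) :
    Tendsto (fun n : ℕ => log⁺ ‖quadIter c n z‖ / 2 ^ n) atTop (𝓝 (quadGreen c z)) :=
  (cauchySeq_of_le_geometric_two (dist_posLog_quadIter_succ hR hc z)).tendsto_limUnder

theorem quadGreen_nonneg (hR : 0 < R) (hc : ∀ n, ‖c n‖ ≤ R) (z : ℂ) : 0 ≤ quadGreen c z :=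
  ge_of_tendsto' (tendsto_quadGreen hR hc z) fun n => div_nonneg posLog_nonneg (by positivity)

theorem dist_posLog_quadIter_quadGreen (hR : 0 < R) (hc : ∀ n, ‖c n‖ ≤ R) (z : ℂ) (n : ℕ) :
    dist (log⁺ ‖quadIter c n z‖ / 2 ^ n) (quadGreen c z) ≤ 2 * Real.log (R + 2) / 2 ^ n :=
  dist_le_of_le_geometric_two_of_tendsto (dist_posLog_quadIter_succ hR hc z)
    (tendsto_quadGreen hR hc z) n

theorem tendstoUniformly_quadGreen (hR : 0 < R) (hc : ∀ n, ‖c n‖ ≤ R) :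
    TendstoUniformly (fun (n : ℕ) z => log⁺ ‖quadIter c n z‖ / 2 ^ n) (quadGreen c) atTop := by
  rw [Metric.tendstoUniformly_iff]
  intro ε hε
  have h : Tendsto (fun n : ℕ => 2 * Real.log (R + 2) / 2 ^ n) atTop (𝓝 0) :=
    tendsto_const_nhds.div_atTop (tendsto_pow_atTop_atTop_of_one_lt one_lt_two)
  filter_upwards [h.eventually_lt_const hε] with n hn z
  rw [dist_comm]
  exact (dist_posLog_quadIter_quadGreen hR hc z n).trans_lt hn

theorem continuous_posLog_quadIter (c : ℕ → ℂ) (n : ℕ) :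
    Continuous fun z => log⁺ ‖quadIter c n z‖ / 2 ^ n :=
  (continuous_posLog.comp (continuous_quadIter c n).norm).div_const _

theorem continuous_quadGreen (hR : 0 < R) (hc : ∀ n, ‖c n‖ ≤ R) : Continuous (quadGreen c) :=
  (tendstoUniformly_quadGreen hR hc).continuous
    (Frequently.of_forall (continuous_posLog_quadIter c))

theorem tendsto_log_quadIter (hR : 0 < R) (hc : ∀ n, ‖c n‖ ≤ R) {z : ℂ}
    (hz : Tendsto (fun n => quadIter c n z) atTop (Bornology.cobounded ℂ)) :
    Tendsto (fun n : ℕ => Real.log ‖quadIter c n z‖ / 2 ^ n) atTop (𝓝 (quadGreen c z)) := by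
  refine (tendsto_quadGreen hR hc z).congr' ?_
  filter_upwards [(tendsto_norm_atTop_iff_cobounded.2 hz).eventually_ge_atTop 1] with n hn
  rw [posLog_eq_log (by rwa [abs_norm])]

/-- Since the limit is known to exist, a bound along infinitely many `n` is enough; this is all that
normality provides. -/
theorem quadGreen_eq_zero_of_frequently (hR : 0 < R) (hc : ∀ n, ‖c n‖ ≤ R) {z : ℂ} {M : ℝ}
    (hM : ∃ᶠ n in atTop, ‖quadIter c n z‖ ≤ M) : quadGreen c z = 0 := by
  refine le_antisymm ?_ (quadGreen_nonneg hR hc z)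
  have h : Tendsto (fun n : ℕ => log⁺ ‖quadIter c n z‖ / 2 ^ n - log⁺ M / 2 ^ n) atTop
      (𝓝 (quadGreen c z - 0)) := (tendsto_quadGreen hR hc z).sub
    (tendsto_const_nhds.div_atTop (tendsto_pow_atTop_atTop_of_one_lt one_lt_two))
  rw [sub_zero] at h
  refine le_of_tendsto_of_frequently h (hM.mono fun n hn => ?_)
  rw [sub_nonpos]
  exact div_le_div_of_nonneg_right (posLog_le_posLog (norm_nonneg _) hn) (by positivity)

theorem quadGreen_eq_zero (hR : 0 < R) (hc : ∀ n, ‖c n‖ ≤ R) {z : ℂ}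
    (hz : ¬ Tendsto (fun n => quadIter c n z) atTop (Bornology.cobounded ℂ)) :
    quadGreen c z = 0 := by
  refine quadGreen_eq_zero_of_frequently hR hc (M := R + 2) (Frequently.of_forall fun n => ?_)
  by_contra! h
  exact hz (tendsto_quadIter_cobounded hR hc h.le)

/-- The Green function is the logarithmic potential of a probability measure, the weak limit of
pull-backs of the unit circle. -/
theorem exists_hasLogPotential_quadGreen (hR : 0 < R) (hc : ∀ n, ‖c n‖ ≤ R) :
    ∃ μ : ProbabilityMeasure ℂ, HasLogPotential (μ : Measure ℂ) (quadGreen c) ∧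
      (∀ᵐ ζ ∂(μ : Measure ℂ), ‖ζ‖ ≤ R + 2) ∧
      ∀ V : Set ℂ, IsOpen V → (∀ᶠ n in atTop, ∀ z ∈ V, 1 < ‖quadIter c n z‖) →
        (μ : Measure ℂ) V = 0 := by
  let ν : ℕ → ProbabilityMeasure ℂ := fun n =>
    ⟨iterPullback c n unitCircleMeasure, isProbabilityMeasure_iterPullback c n _⟩
  have hν1 : ∀ n, ∀ᵐ ζ ∂(ν n : Measure ℂ), ‖quadIter c n ζ‖ = 1 := fun n =>
    ae_iterPullback (p := fun z => ‖z‖ = 1)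
      (measurableSet_eq_fun measurable_norm measurable_const) ae_unitCircleMeasure c n
  have hB : ∀ n, ∀ᵐ ζ ∂(ν n : Measure ℂ), ‖ζ‖ ≤ R + 2 := fun n =>
    (hν1 n).mono fun ζ h => norm_le_of_norm_quadIter_le_one hR hc h.le
  obtain ⟨μ, L, hL, hLat, hμ⟩ := exists_tendsto_of_ae_norm_le hB
  refine ⟨μ, ?_, ae_norm_le_of_tendsto hμ hB, fun V hV hn => ?_⟩
  · refine HasLogPotential.of_tendsto hμ hB
      (fun n => hasLogPotential_unitCircleMeasure.iterPullback c n)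
      (continuous_posLog_quadIter c) (continuous_quadGreen hR hc) ?_
    exact fun s hs => hLat (tendstoUniformly_quadGreen hR hc s hs)
  · have h := ProbabilityMeasure.le_liminf_measure_open_of_tendsto hμ hV
    -- The `n`-th measure is carried by `‖quadIter c n ζ‖ = 1`, a set that eventually misses `V`.
    have h0 : ∀ᶠ n in L, (ν n : Measure ℂ) V = 0 := by
      filter_upwards [hLat hn] with n hn
      refine measure_eq_zero_iff_ae_notMem.2 ((hν1 n).mono fun ζ h1 h2 => ?_)
      exact absurd h1 (hn ζ h2).ne'
    rw [liminf_congr h0, liminf_const] at h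
    exact le_zero_iff.1 h

end dynamics

/-! ### Normal families -/

/-- Near each point of a domain of normality, infinitely many members are bounded or some member
is large. -/
theorem IsNormalFamilyOn.exists_nhds {F : ℕ → C(ℂ, ℂ)} {U : Set ℂ} (h : IsNormalFamilyOn F U)
    (hU : IsOpen U) {z : ℂ} (hz : z ∈ U) (M : ℝ) :
    ∃ V : Set ℂ, IsOpen V ∧ z ∈ V ∧ ((∃ M', ∃ᶠ n in atTop, ∀ w ∈ V, ‖F n w‖ ≤ M') ∨
      ∃ n, ∀ w ∈ V, M < ‖F n w‖) := by
  obtain ⟨k, hk, f, hf⟩ := h id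
  have : LocallyCompactSpace U := hU.locallyCompactSpace
  have key : ∀ O : Set (OnePoint ℂ), IsOpen O → f ⟨z, hz⟩ ∈ O → ∃ V : Set ℂ, IsOpen V ∧ z ∈ V ∧
      ∀ᶠ j in atTop, ∀ w ∈ V, (F (k j) w : OnePoint ℂ) ∈ O := by
    intro O hO hfO
    -- The limit maps a compact neighbourhood `K` into `O`, and this condition is open in the
    -- compact-open topology.
    obtain ⟨K, hK, hzK, hKO⟩ := exists_compact_subset (hO.preimage f.continuous) hfO
    refine ⟨Subtype.val '' interior K, hU.isOpenMap_subtype_val _ isOpen_interior,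
      ⟨_, hzK, rfl⟩, ?_⟩
    have := hf.eventually ((ContinuousMap.isOpen_setOfPred_mapsTo hK hO).mem_nhds hKO)
    filter_upwards [this] with j hj
    rintro _ ⟨w, hw, rfl⟩
    exact hj (interior_subset hw)
  -- A limit value `∞` makes some member large near `z`; a finite value `a` bounds the subsequence
  -- near `z`.
  rcases hfz : f ⟨z, hz⟩ with _ | a
  · obtain ⟨V, hV, hzV, hj⟩ := key (((↑) : ℂ → OnePoint ℂ) '' Metric.closedBall 0 M)ᶜ
      (OnePoint.isOpen_compl_image_coe.2
        ⟨Metric.isClosed_closedBall, isCompact_closedBall 0 M⟩)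
      (by rw [hfz]; rintro ⟨x, -, hx⟩; exact OnePoint.coe_ne_infty x hx)
    obtain ⟨j, hj⟩ := hj.exists
    refine ⟨V, hV, hzV, Or.inr ⟨k j, fun w hw => ?_⟩⟩
    by_contra! hle
    exact hj w hw ⟨_, by simpa using hle, rfl⟩
  · obtain ⟨V, hV, hzV, hj⟩ := key (((↑) : ℂ → OnePoint ℂ) '' Metric.ball a 1)
      (OnePoint.isOpenEmbedding_coe.isOpenMap _ Metric.isOpen_ball)
      (by rw [hfz]; exact ⟨a, Metric.mem_ball_self one_pos, rfl⟩)
    refine ⟨V, hV, hzV, Or.inl ⟨‖a‖ + 1, ?_⟩⟩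
    refine hk.tendsto_atTop.frequently (hj.frequently.mono fun j hj w hw => ?_)
    obtain ⟨x, hx, hxe⟩ := hj w hw
    rw [← OnePoint.coe_injective hxe]
    rw [Metric.mem_ball, dist_eq_norm] at hx
    have := norm_sub_norm_le x a
    linarith

/-! ### Test functions and uniqueness of the Laplacian -/

/-- The indicator of a bounded open set is a pointwise limit of test functions supported in it. -/
theorem IsOpen.exists_contDiff_tendsto_indicator {W : Set ℂ} (hW : IsOpen W)
    (hb : Bornology.IsBounded W) :
    ∃ φ : ℕ → ℂ → ℝ, (∀ n, ContDiff ℝ (⊤ : ℕ∞) (φ n)) ∧ (∀ n, HasCompactSupport (φ n)) ∧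
      (∀ n, tsupport (φ n) ⊆ W) ∧ (∀ n x, φ n x ∈ Icc (0 : ℝ) 1) ∧
      ∀ x, Tendsto (fun n => φ n x) atTop (𝓝 (W.indicator 1 x)) := by
  -- `f` is positive exactly on `W`. The cutoff of `n * f - 1` is supported in the closed set `1 ≤ n
  -- * f`, inside `W`, and equals `1` once `n * f ≥ 2`.
  obtain ⟨f, hf, hfs, hf01⟩ := hW.exists_contDiff_support_eq (n := ⊤)
  have h01 : ∀ x, 0 ≤ f x := fun x => (hf01 (mem_range_self x)).1
  have hts : ∀ n : ℕ, tsupport (fun x => Real.smoothTransition (n * f x - 1)) ⊆ W := fun n => by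
    have hcl : IsClosed {x | 1 ≤ n * f x} :=
      isClosed_le continuous_const (continuous_const.mul hfs.continuous)
    refine (closure_minimal (fun x hx => ?_) hcl).trans fun x (hx : 1 ≤ n * f x) => ?_
    · by_contra hlt
      have hlt' : n * f x < 1 := not_le.1 hlt
      exact hx (Real.smoothTransition.zero_of_nonpos (by linarith))
    · rw [← hf, Function.mem_support]
      rintro h0
      rw [h0] at hx
      linarith
  refine ⟨fun n x => Real.smoothTransition (n * f x - 1), fun n => ?_, fun n => ?_, hts,
    fun n x => ⟨Real.smoothTransition.nonneg _, Real.smoothTransition.le_one _⟩, fun x => ?_⟩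
  · exact Real.smoothTransition.contDiff.comp ((contDiff_const.mul hfs).sub contDiff_const)
  · exact HasCompactSupport.of_support_subset_isCompact hb.isCompact_closure
      ((subset_tsupport _).trans ((hts n).trans subset_closure))
  · by_cases hx : x ∈ W
    · have hpos : 0 < f x := lt_of_le_of_ne (h01 x) (Ne.symm (by rwa [← hf] at hx))
      rw [indicator_of_mem hx]
      refine tendsto_const_nhds.congr' ?_
      have : Tendsto (fun n : ℕ => n * f x) atTop atTop :=
        tendsto_natCast_atTop_atTop.atTop_mul_const hpos
      filter_upwards [this.eventually_ge_atTop 2] with n hn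
      exact (Real.smoothTransition.one_of_one_le (by linarith)).symm
    · have h0 : f x = 0 := by
        rw [← hf] at hx
        exact Function.notMem_support.1 hx
      rw [indicator_of_notMem hx]
      simp [h0, Real.smoothTransition.zero_of_nonpos]

theorem tendsto_integral_of_tendsto_indicator {W : Set ℂ} (hW : IsOpen W)
    (hb : Bornology.IsBounded W) {μ : Measure ℂ} [IsLocallyFiniteMeasure μ] {φ : ℕ → ℂ → ℝ}
    (hφ : ∀ n, Continuous (φ n)) (hs : ∀ n, tsupport (φ n) ⊆ W)
    (h01 : ∀ n x, φ n x ∈ Icc (0 : ℝ) 1)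
    (ht : ∀ x, Tendsto (fun n => φ n x) atTop (𝓝 (W.indicator 1 x))) :
    Tendsto (fun n => ∫ x, φ n x ∂μ) atTop (𝓝 (μ.real W)) := by
  have hfin : μ W ≠ ⊤ := hb.measure_lt_top.ne
  rw [← integral_indicator_one hW.measurableSet]
  refine tendsto_integral_of_dominated_convergence (W.indicator 1)
    (fun n => (hφ n).aestronglyMeasurable) ?_ (fun n => Eventually.of_forall fun x => ?_)
    (Eventually.of_forall ht)
  · exact (integrable_indicator_iff hW.measurableSet).2 (integrableOn_const hfin)
  · rw [Real.norm_of_nonneg (h01 n x).1]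
    by_cases hx : x ∈ W
    · rw [indicator_of_mem hx]; exact (h01 n x).2
    · rw [image_eq_zero_of_notMem_tsupport fun h => hx (hs n h), indicator_of_notMem hx]

/-- The bounded open subsets of the plane. -/
def boundedOpens : Set (Set ℂ) := {W | IsOpen W ∧ Bornology.IsBounded W}

theorem isPiSystem_boundedOpens : IsPiSystem boundedOpens := fun _ hs _ ht _ =>
  ⟨hs.1.inter ht.1, hs.2.subset inter_subset_left⟩

theorem borel_eq_generateFrom_boundedOpens :
    (inferInstance : MeasurableSpace ℂ) = MeasurableSpace.generateFrom boundedOpens := by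
  have hb : TopologicalSpace.IsTopologicalBasis boundedOpens := by
    refine TopologicalSpace.isTopologicalBasis_of_isOpen_of_nhds (fun W hW => hW.1)
      fun a U ha hU => ?_
    exact ⟨U ∩ Metric.ball a 1, ⟨hU.inter Metric.isOpen_ball,
      Metric.isBounded_ball.subset inter_subset_right⟩,
      ⟨ha, Metric.mem_ball_self one_pos⟩, inter_subset_left⟩
  rw [← hb.borel_eq_generateFrom]
  exact BorelSpace.measurable_eq

namespace IsNormalizedLaplacian

variable {u : ℂ → ℝ} {μ ν : Measure ℂ}

/-- Test functions determine the mass of every bounded open set, and these sets form a π-system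
generating the Borel sets. -/
theorem eq (hμ : IsNormalizedLaplacian u μ) (hν : IsNormalizedLaplacian u ν) : μ = ν := by
  have := hμ.locallyFinite
  have := hν.locallyFinite
  refine Measure.ext_of_generateFrom_of_iUnion boundedOpens
    (fun n : ℕ => Metric.ball (0 : ℂ) n) borel_eq_generateFrom_boundedOpens
    isPiSystem_boundedOpens (Metric.iUnion_ball_nat 0)
    (fun n => ⟨Metric.isOpen_ball, Metric.isBounded_ball⟩)
    (fun n => Metric.isBounded_ball.measure_lt_top.ne) fun W ⟨hW, hb⟩ => ?_
  obtain ⟨φ, hd, hc, hs, h01, ht⟩ := hW.exists_contDiff_tendsto_indicator hb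
  have h1 := tendsto_integral_of_tendsto_indicator hW hb (μ := μ)
    (fun n => (hd n).continuous) hs h01 ht
  have h2 := tendsto_integral_of_tendsto_indicator hW hb (μ := ν)
    (fun n => (hd n).continuous) hs h01 ht
  simp_rw [hμ.integral_eq _ (hd _) (hc _)] at h1
  simp_rw [hν.integral_eq _ (hd _) (hc _)] at h2
  exact (measureReal_eq_measureReal_iff hb.measure_lt_top.ne hb.measure_lt_top.ne).1
    (tendsto_nhds_unique h1 h2)

theorem normalizedLaplacian_eq (h : IsNormalizedLaplacian u μ) : normalizedLaplacian u = μ := by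
  have hex : ∃ μ, IsNormalizedLaplacian u μ := ⟨μ, h⟩
  rw [normalizedLaplacian, dif_pos hex]
  exact hex.choose_spec.eq h

theorem measure_eq_zero (h : IsNormalizedLaplacian u μ) {V : Set ℂ} (hV : IsOpen V)
    (hb : Bornology.IsBounded V) (hu : ∀ z ∈ V, u z = 0) : μ V = 0 := by
  have := h.locallyFinite
  obtain ⟨φ, hd, hc, hs, h01, ht⟩ := hV.exists_contDiff_tendsto_indicator hb
  have h1 := tendsto_integral_of_tendsto_indicator hV hb (μ := μ)
    (fun n => (hd n).continuous) hs h01 ht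
  have h2 : ∀ n, ∫ x, φ n x ∂μ = 0 := fun n => by
    rw [h.integral_eq _ (hd n) (hc n)]
    have : ∀ z, u z * Laplacian.laplacian (φ n) z = 0 := fun z => by
      by_cases hz : z ∈ V
      · rw [hu z hz, zero_mul]
      · have h3 : φ n =ᶠ[𝓝 z] fun _ => 0 :=
          notMem_tsupport_iff_eventuallyEq.1 fun h => hz (hs n h)
        rw [(InnerProductSpace.laplacian_congr_nhds h3).self_of_nhds,
          InnerProductSpace.laplacian_const, Pi.zero_apply, mul_zero]
    simp [this]
  simp_rw [h2] at h1
  have h4 := tendsto_nhds_unique h1 tendsto_const_nhds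
  exact (measureReal_eq_zero_iff hb.measure_lt_top.ne).1 h4

end IsNormalizedLaplacian

/-! ### The random system -/

namespace BoundedRandomQuadraticSystem

variable {Ω : Type*} [MeasurableSpace Ω] {P : Measure Ω} (S : BoundedRandomQuadraticSystem P)

/-- The sequence of parameters along the orbit of `ω`. -/
def param (ω : Ω) (n : ℕ) : ℂ := S.c (S.σ^[n] ω)

theorem norm_param_le (ω : Ω) (n : ℕ) : ‖S.param ω n‖ ≤ S.R :=
  (mem_ball_zero_iff.1 (S.c_mem _)).le

theorem iter_eq (ω : Ω) (n : ℕ) : S.iter ω n = quadIter (S.param ω) n := by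
  induction n with
  | zero => rfl
  | succ n ih => funext z; simp only [iter, quadIter, ih]; rfl

theorem tendsto_log_iter (ω : Ω) {z : ℂ} (hz : z ∈ S.basin ω) :
    Tendsto (fun n : ℕ => Real.log ‖S.iter ω n z‖ / 2 ^ n) atTop
      (𝓝 (quadGreen (S.param ω) z)) := by
  simp only [basin, mem_ofPred_eq, iter_eq] at hz
  simp only [iter_eq]
  exact tendsto_log_quadIter S.R_pos (S.norm_param_le ω) hz

/-- On the basin `log` and `log⁺` eventually agree; off it the orbit stays within the escape radius
and the `log⁺` limit is `0`. -/
theorem green_eq (ω : Ω) : S.green ω = quadGreen (S.param ω) := by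
  funext z
  unfold green
  split_ifs with hz
  · exact (S.tendsto_log_iter ω hz).limUnder_eq
  · simp only [basin, mem_ofPred_eq, iter_eq] at hz
    exact (quadGreen_eq_zero S.R_pos (S.norm_param_le ω) hz).symm

theorem continuous_green (ω : Ω) : Continuous (S.green ω) := by
  rw [green_eq]
  exact continuous_quadGreen S.R_pos (S.norm_param_le ω)

theorem green_nonneg (ω : Ω) (z : ℂ) : 0 ≤ S.green ω z := by
  rw [green_eq]
  exact quadGreen_nonneg S.R_pos (S.norm_param_le ω) z

/-- Uniqueness of the normalized Laplacian transfers the properties of the weak limit to the measure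
picked by choice. -/
theorem equilibriumMeasure_spec (ω : Ω) :
    IsProbabilityMeasure (S.equilibriumMeasure ω) ∧
      HasLogPotential (S.equilibriumMeasure ω) (S.green ω) ∧
      (∀ᵐ ζ ∂(S.equilibriumMeasure ω), ‖ζ‖ ≤ S.R + 2) ∧
      ∀ V : Set ℂ, IsOpen V → (∀ᶠ n in atTop, ∀ z ∈ V, 1 < ‖S.iter ω n z‖) →
        S.equilibriumMeasure ω V = 0 := by
  obtain ⟨μ, hμ, hB, hV⟩ := exists_hasLogPotential_quadGreen S.R_pos (S.norm_param_le ω)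
  have hu := continuous_quadGreen S.R_pos (S.norm_param_le ω)
  simp only [equilibriumMeasure, green_eq, (hμ.isNormalizedLaplacian hu).normalizedLaplacian_eq,
    iter_eq]
  exact ⟨inferInstance, hμ, hB, hV⟩

instance isProbabilityMeasure_equilibriumMeasure (ω : Ω) :
    IsProbabilityMeasure (S.equilibriumMeasure ω) := (S.equilibriumMeasure_spec ω).1

theorem hasLogPotential_green (ω : Ω) : HasLogPotential (S.equilibriumMeasure ω) (S.green ω) :=
  (S.equilibriumMeasure_spec ω).2.1

theorem isNormalizedLaplacian_green (ω : Ω) :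
    IsNormalizedLaplacian (S.green ω) (S.equilibriumMeasure ω) :=
  (S.hasLogPotential_green ω).isNormalizedLaplacian (S.continuous_green ω)

theorem equilibriumMeasure_compl_julia (ω : Ω) : S.equilibriumMeasure ω (S.julia ω)ᶜ = 0 := by
  -- Countably many null neighbourhoods cover the complement, so no measurability of the Julia set
  -- is needed.
  refine measure_null_of_locally_null _ fun z hz => ?_
  simp only [julia, mem_compl_iff, mem_ofPred_eq, not_forall, not_not] at hz
  obtain ⟨U, hU, hzU, hn⟩ := hz
  obtain ⟨V, hV, hzV, hcase⟩ := hn.exists_nhds hU hzU (S.R + 2)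
  refine ⟨V ∩ Metric.ball z 1, mem_nhdsWithin_of_mem_nhds
    (inter_mem (hV.mem_nhds hzV) (Metric.ball_mem_nhds z one_pos)), ?_⟩
  rcases hcase with ⟨M, hM⟩ | ⟨n, hn⟩
  · refine (S.isNormalizedLaplacian_green ω).measure_eq_zero (hV.inter Metric.isOpen_ball)
      (Metric.isBounded_ball.subset inter_subset_right) fun w hw => ?_
    rw [green_eq]
    refine quadGreen_eq_zero_of_frequently S.R_pos (S.norm_param_le ω) (M := M) ?_
    exact hM.mono fun n h => by simpa only [ContinuousMap.coe_mk, iter_eq] using h w hw.1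
  · refine measure_mono_null inter_subset_left ((S.equilibriumMeasure_spec ω).2.2.2 V hV ?_)
    filter_upwards [eventually_ge_atTop n] with m hm w hw
    obtain ⟨k, rfl⟩ := Nat.exists_eq_add_of_le hm
    have h1 := hn w hw
    simp only [ContinuousMap.coe_mk, iter_eq] at h1 ⊢
    have h2 := two_pow_mul_le_norm_quadIter S.R_pos (S.norm_param_le ω) h1.le k
    have h3 : (1 : ℝ) ≤ 2 ^ k := one_le_pow₀ (by norm_num)
    nlinarith [S.R_pos]

theorem restrict_julia (ω : Ω) :
    (S.equilibriumMeasure ω).restrict (S.julia ω) = S.equilibriumMeasure ω :=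
  Measure.restrict_eq_self_of_ae_mem (ae_iff.2 (S.equilibriumMeasure_compl_julia ω))

theorem deriv_fiberMap (ω : Ω) (z : ℂ) : deriv (S.fiberMap ω) z = 2 * z := by
  have : HasDerivAt (S.fiberMap ω) _ z := (hasDerivAt_pow 2 z).add_const (S.c ω)
  rw [this.deriv]
  simp

/-- The two sides differ at `z = 0`, where `Real.log 0 = 0`; that point is not an atom. -/
theorem log_two_mul_ae_eq (ω : Ω) : (fun z : ℂ => Real.log ‖2 * z‖) =ᵐ[S.equilibriumMeasure ω]
    fun z => Real.log 2 + Real.log ‖0 - z‖ := by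
  filter_upwards [(S.hasLogPotential_green ω).ae_ne 0] with z hz
  rw [zero_sub, neg_ne_zero] at hz
  rw [zero_sub, norm_neg, norm_mul, Real.log_mul (by simp) (norm_ne_zero_iff.2 hz)]
  simp

theorem integrable_log_two_mul (ω : Ω) :
    Integrable (fun z : ℂ => Real.log ‖2 * z‖) (S.equilibriumMeasure ω) :=
  ((integrable_const _).add ((S.hasLogPotential_green ω).integrable 0)).congr
    (S.log_two_mul_ae_eq ω).symm

theorem integral_log_two_mul (ω : Ω) :
    ∫ z, Real.log ‖2 * z‖ ∂(S.equilibriumMeasure ω) = Real.log 2 + S.green ω 0 := by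
  rw [integral_congr_ae (S.log_two_mul_ae_eq ω),
    integral_add (integrable_const _) ((S.hasLogPotential_green ω).integrable 0),
    (S.hasLogPotential_green ω).integral_eq]
  simp

theorem fiberLyapunov_eq (ω : Ω) : S.fiberLyapunov ω = Real.log 2 + S.green ω 0 := by
  simp only [fiberLyapunov, deriv_fiberMap, restrict_julia, integral_log_two_mul]

theorem measurable_iter (n : ℕ) : Measurable fun p : Ω × ℂ => S.iter p.1 n p.2 := by
  induction n with
  | zero => exact measurable_snd
  | succ n ih =>
    have h : Measurable fun p : Ω × ℂ => S.c (S.σ^[n] p.1) :=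
      S.measurable_c.comp ((S.σ.measurable.iterate n).comp measurable_fst)
    exact (ih.pow_const 2).add h

/-- The everywhere convergent `log⁺` sequence avoids any discussion of the measurability of the
basin. -/
theorem measurable_green : Measurable fun p : Ω × ℂ => S.green p.1 p.2 := by
  have h : ∀ n : ℕ, Measurable fun p : Ω × ℂ => log⁺ ‖S.iter p.1 n p.2‖ / 2 ^ n := fun n =>
    (continuous_posLog.measurable.comp (S.measurable_iter n).norm).div_const _
  refine measurable_of_tendsto_metrizable h (tendsto_pi_nhds.2 fun p => ?_)
  simp only [green_eq, iter_eq]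
  exact tendsto_quadGreen S.R_pos (S.norm_param_le p.1) p.2

/-- Against a test function, `μ_ω` integrates to a multiple of `∫ g_ω Δφ`, measurable in `ω` by
joint measurability of the Green function; bounded open sets follow by monotone-class reasoning from
limits of test functions. -/
theorem measurable_equilibriumMeasure : Measurable S.equilibriumMeasure := by
  refine Measurable.measure_of_isPiSystem_of_isProbabilityMeasure
    borel_eq_generateFrom_boundedOpens isPiSystem_boundedOpens fun W ⟨hW, hb⟩ => ?_
  obtain ⟨φ, hd, hc, hs, h01, ht⟩ := hW.exists_contDiff_tendsto_indicator hb
  have hm : ∀ n, Measurable fun ω => ∫ z, φ n z ∂(S.equilibriumMeasure ω) := fun n => by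
    simp_rw [fun ω => (S.isNormalizedLaplacian_green ω).integral_eq _ (hd n) (hc n)]
    refine Measurable.const_mul ?_ _
    refine (StronglyMeasurable.integral_prod_right
      (f := fun ω z => S.green ω z * Laplacian.laplacian (φ n) z) ?_).measurable
    refine (S.measurable_green.mul ?_).stronglyMeasurable
    exact (continuous_laplacian (contDiff_infty.1 (hd n) 2)).measurable.comp measurable_snd
  have hr : Measurable fun ω => (S.equilibriumMeasure ω).real W :=
    measurable_of_tendsto_metrizable hm (tendsto_pi_nhds.2 fun ω =>
      tendsto_integral_of_tendsto_indicator hW hb (fun n => (hd n).continuous) hs h01 ht)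
  simpa [Measure.real] using hr.ennreal_ofReal

/-- The equilibrium measures as a Markov kernel. -/
noncomputable def equilibriumKernel : ProbabilityTheory.Kernel Ω ℂ :=
  ⟨S.equilibriumMeasure, S.measurable_equilibriumMeasure⟩

instance isMarkovKernel_equilibriumKernel :
    ProbabilityTheory.IsMarkovKernel S.equilibriumKernel :=
  ⟨S.isProbabilityMeasure_equilibriumMeasure⟩

/-- In this form Fubini's theorem for kernels applies to the global measure. -/
theorem globalMeasure_eq [SFinite P] : S.globalMeasure = P.compProd S.equilibriumKernel := by
  rw [globalMeasure, Measure.compProd_eq_comp_prod]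
  congr 1
  funext ω
  rw [ProbabilityTheory.Kernel.prod_apply, ProbabilityTheory.Kernel.id_apply, Measure.dirac_prod]
  rfl

theorem green_zero_le (ω : Ω) : S.green ω 0 ≤ S.R + 2 := by
  rw [← (S.hasLogPotential_green ω).integral_eq]
  have := integral_mono_ae ((S.hasLogPotential_green ω).integrable 0)
    (integrable_const (S.R + 2)) (by
      filter_upwards [(S.equilibriumMeasure_spec ω).2.2.1] with ζ hζ
      rw [zero_sub, norm_neg]
      exact (Real.log_le_self (norm_nonneg _)).trans hζ)
  simpa using this

theorem integrable_green_zero [IsProbabilityMeasure P] : Integrable (fun ω => S.green ω 0) P := by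
  refine Integrable.mono' (integrable_const (S.R + 2))
    (S.measurable_green.comp measurable_prodMk_right).aestronglyMeasurable
    (Eventually.of_forall fun ω => ?_)
  rw [Real.norm_of_nonneg (S.green_nonneg ω 0)]
  exact S.green_zero_le ω

/-- Again `|k| ≤ 2 * C - k`, now with `C = 2 * (R + 2)` from the common support. The negative part
is controlled by `g_ω(0) ≥ 0`, so the bound is uniform in `ω`. -/
theorem integral_abs_log_two_mul_le (ω : Ω) :
    ∫ z, ‖Real.log ‖2 * z‖‖ ∂(S.equilibriumMeasure ω) ≤ 4 * (S.R + 2) := by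
  have h := S.integrable_log_two_mul ω
  have h1 : ∫ z, (4 * (S.R + 2) - Real.log ‖2 * z‖) ∂(S.equilibriumMeasure ω) ≤
      4 * (S.R + 2) := by
    rw [integral_sub (integrable_const _) h, integral_log_two_mul]
    have := S.green_nonneg ω 0
    have := Real.log_nonneg one_le_two
    simp only [integral_const, probReal_univ, smul_eq_mul, one_mul]
    linarith
  refine le_trans (integral_mono_ae h.norm ((integrable_const _).sub h) ?_) h1
  filter_upwards [(S.equilibriumMeasure_spec ω).2.2.1] with z hz
  have h2 : Real.log ‖2 * z‖ ≤ 2 * (S.R + 2) := by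
    refine (Real.log_le_self (norm_nonneg _)).trans ?_
    rw [norm_mul]
    simpa using hz
  have := S.R_pos
  rw [Real.norm_eq_abs, Pi.sub_apply]
  exact abs_le.2 ⟨by linarith, by linarith⟩

theorem integrable_globalMeasure [IsProbabilityMeasure P] :
    Integrable (fun p : Ω × ℂ => Real.log ‖2 * p.2‖) S.globalMeasure ∧
      ∫ p, Real.log ‖2 * p.2‖ ∂S.globalMeasure =
        ∫ ω, ∫ z, Real.log ‖2 * z‖ ∂(S.equilibriumMeasure ω) ∂P := by
  have hm : Measurable fun p : Ω × ℂ => Real.log ‖2 * p.2‖ := by fun_prop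
  have hi : Integrable (fun p : Ω × ℂ => Real.log ‖2 * p.2‖) (P.compProd S.equilibriumKernel) := by
    rw [Measure.integrable_compProd_iff hm.aestronglyMeasurable]
    refine ⟨Eventually.of_forall fun ω => S.integrable_log_two_mul ω, ?_⟩
    refine Integrable.mono' (integrable_const (4 * (S.R + 2))) ?_
      (Eventually.of_forall fun ω => ?_)
    · exact (StronglyMeasurable.integral_kernel_prod_right' (κ := S.equilibriumKernel)
        hm.stronglyMeasurable.norm).aestronglyMeasurable
    · rw [Real.norm_of_nonneg (integral_nonneg fun _ => norm_nonneg _)]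
      exact S.integral_abs_log_two_mul_le ω
  rw [globalMeasure_eq]
  exact ⟨hi, Measure.integral_compProd hi⟩

end BoundedRandomQuadraticSystem

theorem proposition4p1 {Ω : Type*} [MeasurableSpace Ω] (P : Measure Ω) [IsProbabilityMeasure P]
    [P.IsComplete] (S : BoundedRandomQuadraticSystem P) :
    -- the fiberwise objects are well defined, for every `ω`
    (∀ ω : Ω,
      (∀ z ∈ S.basin ω,
        Tendsto (fun n : ℕ => Real.log ‖S.iter ω n z‖ / 2 ^ n) atTop (𝓝 (S.green ω z))) ∧
      IsNormalizedLaplacian (S.green ω) (S.equilibriumMeasure ω) ∧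
      IsProbabilityMeasure (S.equilibriumMeasure ω) ∧
      S.equilibriumMeasure ω (S.julia ω)ᶜ = 0 ∧
      S.equilibriumMeasure ω {0} = 0 ∧
      IntegrableOn (fun z => Real.log ‖deriv (S.fiberMap ω) z‖) (S.julia ω)
        (S.equilibriumMeasure ω)) ∧
    -- the fiberwise formula, for every `ω`
    (∀ ω : Ω,
      S.fiberLyapunov ω = ∫ z in S.julia ω, Real.log ‖2 * z‖ ∂(S.equilibriumMeasure ω) ∧
      S.fiberLyapunov ω = Real.log 2 + S.green ω 0) ∧
    -- the global objects are well defined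
    Measurable S.equilibriumMeasure ∧
    Integrable (fun ω => S.green ω 0) P ∧
    Integrable S.fiberLyapunov P ∧
    Integrable (fun p : Ω × ℂ => Real.log ‖deriv (S.fiberMap p.1) p.2‖) S.globalMeasure ∧
    -- the global formula
    S.globalLyapunov = ∫ p, Real.log ‖deriv (S.fiberMap p.1) p.2‖ ∂S.globalMeasure ∧
    S.globalLyapunov = Real.log 2 + S.globalGreen 0 := by
  refine ⟨fun ω => ⟨fun z hz => ?_, S.isNormalizedLaplacian_green ω, inferInstance,
    S.equilibriumMeasure_compl_julia ω, (S.hasLogPotential_green ω).singleton 0, ?_⟩,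
    fun ω => ⟨?_, S.fiberLyapunov_eq ω⟩, S.measurable_equilibriumMeasure,
    S.integrable_green_zero, ?_, ?_, ?_, ?_⟩
  · rw [S.green_eq]
    exact S.tendsto_log_iter ω hz
  · simp only [S.deriv_fiberMap]
    exact (S.integrable_log_two_mul ω).integrableOn
  · simp only [BoundedRandomQuadraticSystem.fiberLyapunov, S.deriv_fiberMap]
  · simp only [funext S.fiberLyapunov_eq]
    exact (integrable_const _).add S.integrable_green_zero
  · simp only [S.deriv_fiberMap]
    exact S.integrable_globalMeasure.1
  · simp only [S.deriv_fiberMap]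
    rw [S.integrable_globalMeasure.2]
    simp only [BoundedRandomQuadraticSystem.globalLyapunov, S.fiberLyapunov_eq,
      S.integral_log_two_mul]
  · simp only [BoundedRandomQuadraticSystem.globalLyapunov, S.fiberLyapunov_eq]
    rw [integral_add (integrable_const _) S.integrable_green_zero]
    simp [BoundedRandomQuadraticSystem.globalGreen]
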